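/- Let $X=(X_1,\dots,X_d)$ be a random vector in $\mathbb{R}^d$ whose univariate marginal distribution functions $F_1,\dots,F_d$ are continuous, let $U=(F_1(X_1),\dots,F_d(X_d))$ (so that the law of $U$ is the copula of $X$), and let $\mathbf X_1,\mathbf X_2,\dots$, $\mathbf X_r=(X_{r1},\dots,X_{rd})$, be independent copies of $X$. Put $p=d(d-1)/2$ and index the coordinates of $\mathbb{R}^p$ by the pairs $r=(i_r,j_r)$ with $1\le i_r<j_r\le d$. From the first $n\ge 2$ observations form the vector $\hat\tau=\hat\tau_n\in\mathbb{R}^p$ of empirical Kendall's taus, $$\hat\tau_{(i,j)}=-1+\frac{4}{n(n-1)}\sum_{r\ne s}\mathbf 1(X_{ri}\le X_{si})\,\mathbf 1(X_{rj}\le X_{sj}),\qquad i<j .$$ For $i<j$ let $C_{ij}(u,v)=\Pr(U_i\le u,\,U_j\le v)$ and $\bar C_{ij}(u,v)=\Pr(U_i>u,\,U_j>v)$, and let $\Sigma_\infty\in\mathbb{R}^{p\times p}$ be the asymptotic variance of $\sqrt n\,\hat\tau$, that is, the matrix with entries $$(\Sigma_\infty)_{rs}=16\,\mathrm{cov}\bigl\{C_{i_rj_r}(U_{i_r},U_{j_r})+\bar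 C_{i_rj_r}(U_{i_r},U_{j_r}),\;C_{i_sj_s}(U_{i_s},U_{j_s})+\bar C_{i_sj_s}(U_{i_s},U_{j_s})\bigr\}.$$ Let $\mathcal G=\{\mathcal G_1,\dots,\mathcal G_K\}$ be a partition of $\{1,\dots,d\}$ that satisfies the Partial Exchangeability Assumption (PEA): for every permutation $\pi$ of $\{1,\dots,d\}$ such that $j\in\mathcal G_k\Leftrightarrow\pi(j)\in\mathcal G_k$ for all $j$ and $k$, the vectors $(U_1,\dots,U_d)$ and $(U_{\pi(1)},\dots,U_{\pi(d)})$ have the same distribution. For $k_1\le k_2$ let $\mathcal B_{k_1k_2}$ be the set of all pairs $r$ with $(i_r,j_r)\in(\mathcal G_{k_1}\times\mathcal G_{k_2})\cup(\mathcal G_{k_2}\times\mathcal G_{k_1})$. The nonempty ones among these sets are the distinct blocks; their number is $$L=\frac{K(K-1)}2+\sum_{k=1}^K\mathbf 1(|\mathcal G_k|>1).$$ Let $\mathbf B$ be the $p\times L$ block membership matrix, with entry $1$ if $r$ lies in the $\ell$-th block and $0$ otherwise, let $\Gamma=\mathbf B\mathbf B^+$, where $^+$ denotes the Moore--Penrose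 inverse, and let $\tilde\tau=\Gamma\hat\tau$. Suppose that $\Sigma_\infty$ is positive definite, and let $\hat\Sigma=\hat\Sigma_n$ be random $p\times p$ matrices such that $\hat\Sigma_n$ is almost surely invertible for every sufficiently large $n$ and, as $n\to\infty$, $n\hat\Sigma_n\to\Sigma_\infty$ element-wise in probability. Then, as $n\to\infty$, $$(\hat\tau-\tilde\tau)^\top\hat\Sigma^{-1}(\hat\tau-\tilde\tau)$$ converges in distribution to the $\chi^2$ law with $p-L$ degrees of freedom (the point mass at $0$ if $p=L$). -/

import Mathlib

open MeasureTheory ProbabilityTheory Filter Topology Matrix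

namespace KendallBlock

noncomputable section

/-! ### The copula of a random vector -/

/-- The vector `(F₁(x₁), …, F_d(x_d))`, where `F_j` is the distribution function of the `j`-th
univariate marginal of `ν`. -/
def probTransform {d : ℕ} (ν : Measure (Fin d → ℝ)) (x : Fin d → ℝ) : Fin d → ℝ :=
  fun j => cdf (ν.map (fun y => y j)) (x j)

/-- The law of `U = (F₁(X₁), …, F_d(X_d))` when `X` has law `ν`. If the marginals are continuous,
the distribution function of this law is the unique copula of `ν`. -/
def copulaLaw {d : ℕ} (ν : Measure (Fin d → ℝ)) : Measure (Fin d → ℝ) :=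
  ν.map (probTransform ν)

/-- The bivariate copula `C_{ij}(u, v) = Pr(U_i ≤ u, U_j ≤ v)`. -/
def copula₂ {d : ℕ} (ν : Measure (Fin d → ℝ)) (i j : Fin d) (u v : ℝ) : ℝ :=
  (copulaLaw ν).real {w | w i ≤ u ∧ w j ≤ v}

/-- The survival function `Pr(U_i > u, U_j > v)` of the bivariate copula `C_{ij}`. -/
def copulaSurvival₂ {d : ℕ} (ν : Measure (Fin d → ℝ)) (i j : Fin d) (u v : ℝ) : ℝ :=
  (copulaLaw ν).real {w | u < w i ∧ v < w j}

/-- The partial exchangeability assumption for the partition `G` of `{1, …, d}`: for every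
permutation `π` that preserves every cluster of `G`, the vectors `(U₁, …, U_d)` and
`(U_{π(1)}, …, U_{π(d)})` have the same law. -/
def PEA {d : ℕ} (ν : Measure (Fin d → ℝ)) (G : Finpartition (Finset.univ : Finset (Fin d))) :
    Prop :=
  ∀ π : Equiv.Perm (Fin d), (∀ A ∈ G.parts, ∀ j, j ∈ A ↔ π j ∈ A) →
    (copulaLaw ν).map (fun u j => u (π j)) = copulaLaw ν

/-! ### Vectorization and blocks -/

/-- The positions `(i, j)`, `i < j`, above the main diagonal of a `d × d` matrix. There are
`p = d (d - 1) / 2` of them, and they index the entries of the vectorized matrices. -/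
abbrev PairIdx (d : ℕ) : Type := {e : Fin d × Fin d // e.1 < e.2}

/-- The block of the pairs that have one index in `A` and the other one in `A'`. -/
def block {d : ℕ} (A A' : Finset (Fin d)) : Finset (PairIdx d) :=
  {r | (r.1.1 ∈ A ∧ r.1.2 ∈ A') ∨ (r.1.1 ∈ A' ∧ r.1.2 ∈ A)}

/-- The set of the nonempty blocks that the clusters of `G` induce. -/
def blocks {d : ℕ} (G : Finpartition (Finset.univ : Finset (Fin d))) :
    Finset (Finset (PairIdx d)) :=
  ((G.parts ×ˢ G.parts).image (fun q => block q.1 q.2)).filter (fun b => b.Nonempty)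

/-- The number of distinct blocks, `L = K (K - 1) / 2 + ∑ₖ 1(|G_k| > 1)`, where `K` is the number
of clusters. -/
def numBlocks {d : ℕ} (G : Finpartition (Finset.univ : Finset (Fin d))) : ℕ :=
  G.parts.card * (G.parts.card - 1) / 2 + ∑ A ∈ G.parts, if 1 < A.card then 1 else 0

/-- The block membership matrix: its entry `(r, ℓ)` is `1` if `r` lies in the block `ℓ` and `0`
otherwise. -/
def blockMatrix {d : ℕ} (G : Finpartition (Finset.univ : Finset (Fin d))) :
    Matrix (PairIdx d) {b // b ∈ blocks G} ℝ :=
  Matrix.of fun r ℓ => if r ∈ ℓ.1 then 1 else 0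

/-! ### The Moore-Penrose inverse -/

/-- The four Penrose equations, for real matrices. -/
structure IsMoorePenrose {m n : Type*} [Fintype m] [Fintype n] (A : Matrix m n ℝ)
    (M : Matrix n m ℝ) : Prop where
  mul_mul_self : A * M * A = A
  self_mul_mul : M * A * M = M
  symm_left : (A * M)ᵀ = A * M
  symm_right : (M * A)ᵀ = M * A

theorem exists_symm_inverse {n : Type*} [Fintype n] [DecidableEq n] (S : Matrix n n ℝ)
    (hS : S.IsHermitian) :
    ∃ R : Matrix n n ℝ, Rᵀ = R ∧ S * R * S = S ∧ R * S * R = R ∧ S * R = R * S := by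
  have key : ∀ a : ℝ, a * a⁻¹ * a = a := fun a => by
    by_cases h : a = 0 <;> simp [h]
  have key' : ∀ a : ℝ, a⁻¹ * a * a⁻¹ = a⁻¹ := fun a => by
    by_cases h : a = 0 <;> simp [h]
  obtain ⟨φ, D, hD⟩ : ∃ (φ : Matrix n n ℝ ≃⋆ₐ[ℝ] Matrix n n ℝ) (D : n → ℝ),
      S = φ (Matrix.diagonal D) := ⟨_, _, hS.spectral_theorem⟩
  refine ⟨φ (Matrix.diagonal fun i => (D i)⁻¹), ?_, ?_, ?_, ?_⟩
  · rw [← Matrix.conjTranspose_eq_transpose_of_trivial, ← Matrix.star_eq_conjTranspose,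
      ← map_star, Matrix.star_eq_conjTranspose, Matrix.diagonal_conjTranspose]
    rfl
  · rw [hD, ← map_mul, ← map_mul, Matrix.diagonal_mul_diagonal, Matrix.diagonal_mul_diagonal]
    simp only [key]
  · rw [hD, ← map_mul, ← map_mul, Matrix.diagonal_mul_diagonal, Matrix.diagonal_mul_diagonal]
    simp only [key']
  · rw [hD, ← map_mul, ← map_mul, Matrix.diagonal_mul_diagonal, Matrix.diagonal_mul_diagonal]
    simp only [mul_comm]

theorem exists_isMoorePenrose {m n : Type*} [Fintype m] [Fintype n] (A : Matrix m n ℝ) :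
    ∃ M : Matrix n m ℝ, IsMoorePenrose A M := by
  classical
  obtain ⟨R, hR, h1, h2, h3⟩ := exists_symm_inverse (Aᵀ * A)
    (by simpa using Matrix.isHermitian_conjTranspose_mul_self A)
  have hA : A * (R * (Aᵀ * A)) = A := by
    have h0 : (A * (R * (Aᵀ * A)) - A)ᵀ * (A * (R * (Aᵀ * A)) - A) = 0 := by
      have e : (A * (R * (Aᵀ * A)) - A)ᵀ * (A * (R * (Aᵀ * A)) - A)
          = (Aᵀ * A) * R * ((Aᵀ * A) * R * (Aᵀ * A)) - (Aᵀ * A) * R * (Aᵀ * A)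
            - ((Aᵀ * A) * R * (Aᵀ * A) - Aᵀ * A) := by
        simp only [Matrix.transpose_sub, Matrix.transpose_mul, Matrix.transpose_transpose, hR,
          Matrix.sub_mul, Matrix.mul_sub, Matrix.mul_assoc]
      rw [e, h1, h1]
      simp
    rw [← Matrix.conjTranspose_eq_transpose_of_trivial,
      Matrix.conjTranspose_mul_self_eq_zero] at h0
    exact sub_eq_zero.mp h0
  refine ⟨R * Aᵀ, ?_, ?_, ?_, ?_⟩
  · simpa only [Matrix.mul_assoc] using hA
  · rw [Matrix.mul_assoc R Aᵀ A, ← Matrix.mul_assoc (R * (Aᵀ * A)), h2]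
  · simp only [Matrix.transpose_mul, Matrix.transpose_transpose, hR, Matrix.mul_assoc]
  · rw [Matrix.mul_assoc R Aᵀ A, Matrix.transpose_mul, hR, ← h3, Matrix.transpose_mul,
      Matrix.transpose_transpose]

theorem IsMoorePenrose.unique {m n : Type*} [Fintype m] [Fintype n] {A : Matrix m n ℝ}
    {M N : Matrix n m ℝ} (hM : IsMoorePenrose A M) (hN : IsMoorePenrose A N) : M = N := by
  have e1 : A * M = A * N := by
    calc A * M = (A * N * A) * M := by rw [hN.mul_mul_self]
      _ = ((A * M) * (A * N))ᵀ := by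
          rw [Matrix.transpose_mul, hM.symm_left, hN.symm_left]
          simp only [Matrix.mul_assoc]
      _ = A * N := by
          rw [← Matrix.mul_assoc, hM.mul_mul_self, hN.symm_left]
  have e2 : M * A = N * A := by
    calc M * A = M * (A * N * A) := by rw [hN.mul_mul_self]
      _ = ((N * A) * (M * A))ᵀ := by
          rw [Matrix.transpose_mul, hM.symm_right, hN.symm_right]
          simp only [Matrix.mul_assoc]
      _ = N * A := by
          rw [Matrix.mul_assoc, ← Matrix.mul_assoc A, hM.mul_mul_self, hN.symm_right]
  calc M = M * A * M := hM.self_mul_mul.symm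
    _ = N * A * N := by rw [e2, Matrix.mul_assoc, e1, ← Matrix.mul_assoc]
    _ = N := hN.self_mul_mul

/-- The Moore-Penrose inverse `A⁺` of a real matrix: the unique solution of the Penrose
equations. -/
def moorePenrose {m n : Type*} [Fintype m] [Fintype n] (A : Matrix m n ℝ) : Matrix n m ℝ :=
  Classical.choose (exists_isMoorePenrose A)

theorem moorePenrose_spec {m n : Type*} [Fintype m] [Fintype n] (A : Matrix m n ℝ) :
    IsMoorePenrose A (moorePenrose A) :=
  Classical.choose_spec (exists_isMoorePenrose A)

/-- The matrix `Γ = B B⁺`. -/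
def Gam {d : ℕ} (G : Finpartition (Finset.univ : Finset (Fin d))) :
    Matrix (PairIdx d) (PairIdx d) ℝ :=
  blockMatrix G * moorePenrose (blockMatrix G)

/-! ### Kendall's tau: the estimators, the asymptotic variance and the loss -/

/-- The empirical Kendall's tau of the coordinates `i` and `j` of the first `n` terms of the
sequence `x` of observations. -/
def empiricalTau {d : ℕ} (n : ℕ) (x : ℕ → Fin d → ℝ) (i j : Fin d) : ℝ :=
  -1 + 4 / ((n : ℝ) * ((n : ℝ) - 1)) *
    ∑ r ∈ Finset.range n, ∑ s ∈ Finset.range n,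
      if r ≠ s ∧ x r i ≤ x s i ∧ x r j ≤ x s j then 1 else 0

/-- The vectorized empirical Kendall's tau matrix `τ̂`. -/
def tauHat {d : ℕ} (n : ℕ) (x : ℕ → Fin d → ℝ) : PairIdx d → ℝ :=
  fun r => empiricalTau n x r.1.1 r.1.2

/-- The improved estimator `τ̃(τ̂ | G) = Γ τ̂`. -/
def tauTilde {d : ℕ} (G : Finpartition (Finset.univ : Finset (Fin d))) (τhat : PairIdx d → ℝ) :
    PairIdx d → ℝ :=
  Gam G *ᵥ τhat

/-- The asymptotic variance `Σ_∞` of `τ̂`, whose entry `(r, s)` is `16` times the covariance of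
`C_{ij}(U_i, U_j) + C̄_{ij}(U_i, U_j)` for `(i, j) = r` and for `(i, j) = s`. -/
def SigmaInf {d : ℕ} (ν : Measure (Fin d → ℝ)) : Matrix (PairIdx d) (PairIdx d) ℝ :=
  Matrix.of fun r s => 16 *
    covariance
      (fun w : Fin d → ℝ => copula₂ ν r.1.1 r.1.2 (w r.1.1) (w r.1.2) +
        copulaSurvival₂ ν r.1.1 r.1.2 (w r.1.1) (w r.1.2))
      (fun w : Fin d → ℝ => copula₂ ν s.1.1 s.1.2 (w s.1.1) (w s.1.2) +
        copulaSurvival₂ ν s.1.1 s.1.2 (w s.1.1) (w s.1.2))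
      (copulaLaw ν)

/-- The loss `ℒ(t | τ̂, Σ) = (τ̂ - t)ᵀ Σ⁻¹ (τ̂ - t)`. -/
def loss {d : ℕ} (t τhat : PairIdx d → ℝ) (S : Matrix (PairIdx d) (PairIdx d) ℝ) : ℝ :=
  (τhat - t) ⬝ᵥ (S⁻¹ *ᵥ (τhat - t))

/-- The `χ²` law with `k` degrees of freedom: the law of the sum of the squares of `k` independent
standard normal variables (for `k = 0`, the point mass at `0`). -/
def chiSquared (k : ℕ) : Measure ℝ :=
  (Measure.pi (fun _ : Fin k => gaussianReal 0 1)).map (fun z => ∑ i, z i ^ 2)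

instance isProbabilityMeasure_chiSquared (k : ℕ) : IsProbabilityMeasure (chiSquared k) :=
  Measure.isProbabilityMeasure_map (Measurable.aemeasurable (by fun_prop))

end

end KendallBlock

open KendallBlock

/-!
The loss is a quadratic form in the residual `(1 - Γ) τ̂`, and `Γ` is the orthogonal projection onto
the vectors that are constant on the blocks. Three facts give its limit law.

* **Exchangeability.** The permutations that preserve the clusters act transitively on each block
  (`exists_permPair_eq`), and both the population taus and `Σ_∞` are invariant under them. Hence
  `Γ τ = τ` (`Gam_mulVec_tauPop`), so the residual is `(1 - Γ) (τ̂ - τ)`, and `Γ` commutes with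
  `Σ_∞` (`Gam_mul_SigmaInf`).
* **Asymptotic normality.** The marginals are continuous, so `τ̂` can be computed almost surely from
  the copula sample (`tauHat_probTransform_ae_eq`). Each linear combination of its entries is a
  U-statistic of order two. By Hoeffding's decomposition it is a sum of independent variables plus a
  degenerate part that is negligible in `L²` (`tendstoInDistribution_uStatistic`). The projection of
  the kernel is `C_{ij} + C̄_{ij}`, which gives the variance `Σ_∞`.
* **Whitening.** As `1 - Γ` is a projection of rank `p - L` (`rank_Gam`, `card_blocks`) that
  commutes with `Σ_∞`, there is a matrix `A` with `p - L` rows, `A Σ_∞ Aᵀ = 1` and `Σ_∞ Aᵀ A = 1 - Γ`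
  (`exists_mul_mul_transpose_eq_one`). By the Cramér-Wold device `√n A (τ̂ - τ)` is asymptotically
  standard normal. By Slutsky's theorem the loss has the limit law of the squared norm of this
  vector, since `(n Σ̂)⁻¹ → Σ_∞⁻¹` in probability and `(Σ_∞ Aᵀ)ᵀ Σ_∞⁻¹ (Σ_∞ Aᵀ) = 1`.
-/

/-! ### Second-order U-statistics -/

theorem integral_comp_eq_zero_of_indepFun {Ω S T : Type*} [MeasurableSpace Ω] [MeasurableSpace S]
    [MeasurableSpace T] {P : Measure Ω} [IsProbabilityMeasure P] {μ : Measure S}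
    {V : Ω → S} {Z : Ω → T} (hV : HasLaw V μ P) (hZ : AEMeasurable Z P) (hVZ : IndepFun V Z P)
    {F : S × T → ℝ} (hF : Measurable F) {M : ℝ} (hM : ∀ x, |F x| ≤ M)
    (h0 : ∀ z, ∫ x, F (x, z) ∂μ = 0) : ∫ ω, F (V ω, Z ω) ∂P = 0 := by
  have := hV.isProbabilityMeasure_iff.1 ‹_›
  have := Measure.isProbabilityMeasure_map (μ := P) hZ
  have h1 := (indepFun_iff_map_prod_eq_prod_map_map hV.aemeasurable hZ).1 hVZ
  rw [← integral_map (φ := fun ω => (V ω, Z ω)) (hV.aemeasurable.prodMk hZ)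
    hF.aestronglyMeasurable, h1, hV.map_eq, integral_prod_symm]
  · simp [h0]
  · exact Integrable.of_bound hF.aestronglyMeasurable M (ae_of_all _ hM)

theorem tendstoInMeasure_zero_of_tendsto_integral_sq {Ω ι : Type*} [MeasurableSpace Ω]
    {P : Measure Ω} [IsFiniteMeasure P] {l : Filter ι} {f : ι → Ω → ℝ}
    (hf : ∀ i, Integrable (fun ω => f i ω ^ 2) P)
    (h : Tendsto (fun i => ∫ ω, f i ω ^ 2 ∂P) l (𝓝 0)) : TendstoInMeasure P f l 0 := by
  rw [tendstoInMeasure_iff_measureReal_norm]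
  intro ε hε
  refine squeeze_zero (fun _ => measureReal_nonneg) (fun i => ?_)
    (g := fun i => (ε ^ 2)⁻¹ * ∫ ω, f i ω ^ 2 ∂P) (by simpa using h.const_mul (ε ^ 2)⁻¹)
  have hm := mul_meas_ge_le_integral_of_nonneg (ae_of_all P fun ω => sq_nonneg (f i ω)) (hf i)
    (ε ^ 2)
  have hset : {ω | ε ≤ ‖f i ω - (0 : Ω → ℝ) ω‖} = {ω | ε ^ 2 ≤ f i ω ^ 2} := by
    ext ω
    simp [sq_le_sq, abs_of_pos hε]
  rw [hset, le_inv_mul_iff₀ (by positivity)]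
  exact hm

section UStatistic

variable {Ω S : Type*} [MeasurableSpace Ω] [MeasurableSpace S] {P : Measure Ω}
  [IsProbabilityMeasure P] {μ : Measure S} {U : ℕ → Ω → S}

/-- The terms of a U-statistic with degenerate kernel are uncorrelated, unless they come from the
same unordered pair: one of the indices then occurs only once, and integrating it out first
gives `0`. -/
theorem integral_degenerate_mul_eq_zero (hindep : iIndepFun U P) (hlaw : ∀ n, HasLaw (U n) μ P)
    {ρ : S → S → ℝ} (hρ : Measurable (Function.uncurry ρ)) {M : ℝ} (hM : ∀ x y, |ρ x y| ≤ M)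
    (h1 : ∀ x, ∫ y, ρ x y ∂μ = 0) (h2 : ∀ y, ∫ x, ρ x y ∂μ = 0) {a b c e : ℕ} (hab : a ≠ b)
    (hne1 : (c, e) ≠ (a, b)) (hne2 : (c, e) ≠ (b, a)) :
    ∫ ω, ρ (U a ω) (U b ω) * ρ (U c ω) (U e ω) ∂P = 0 := by
  have hM0 (x y z w : S) : |ρ x y * ρ z w| ≤ M * M := by
    rw [abs_mul]
    exact mul_le_mul (hM _ _) (hM _ _) (abs_nonneg _) ((abs_nonneg _).trans (hM x y))
  have key (i : ℕ) (T : Finset ℕ) (hi : i ∉ T) :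
      IndepFun (U i) (fun ω (j : T) => U j ω) P := by
    have := hindep.indepFun_finset₀ {i} T (by simpa using hi) (fun n => (hlaw n).aemeasurable)
    exact this.comp (φ := fun f : ({i} : Finset ℕ) → S => f ⟨i, by simp⟩) (ψ := id)
      (by fun_prop) measurable_id
  have hT (T : Finset ℕ) : AEMeasurable (fun ω (j : T) => U j ω) P :=
    aemeasurable_pi_lambda _ fun j => (hlaw j).aemeasurable
  have hmeas {α : Type _} [MeasurableSpace α] {f g : α → S} (hf : Measurable f)
      (hg : Measurable g) : Measurable fun x => ρ (f x) (g x) := hρ.comp (hf.prodMk hg)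
  by_cases ha : a ∈ ({c, e} : Finset ℕ)
  · have hb : b ∉ ({a, c, e} : Finset ℕ) := by
      simp only [Finset.mem_insert, Finset.mem_singleton, ne_eq, Prod.mk.injEq] at *
      grind
    refine integral_comp_eq_zero_of_indepFun (hlaw b) (hT {a, c, e}) (key b _ hb)
      (F := fun p => ρ (p.2 ⟨a, by simp⟩) p.1 * ρ (p.2 ⟨c, by simp⟩) (p.2 ⟨e, by simp⟩))
      ((hmeas (by fun_prop) (by fun_prop)).mul (hmeas (by fun_prop) (by fun_prop)))
      (fun _ => hM0 _ _ _ _) fun z => ?_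
    simp [integral_mul_const, h1]
  · have ha' : a ∉ ({b, c, e} : Finset ℕ) := by
      simp only [Finset.mem_insert, Finset.mem_singleton, ne_eq] at *
      grind
    refine integral_comp_eq_zero_of_indepFun (hlaw a) (hT {b, c, e}) (key a _ ha')
      (F := fun p => ρ p.1 (p.2 ⟨b, by simp⟩) * ρ (p.2 ⟨c, by simp⟩) (p.2 ⟨e, by simp⟩))
      ((hmeas (by fun_prop) (by fun_prop)).mul (hmeas (by fun_prop) (by fun_prop)))
      (fun _ => hM0 _ _ _ _) fun z => ?_
    simp [integral_mul_const, h2]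

/-- Only `2 n (n - 1)` of the terms of the expanded square survive, so the sum is of order `n` and
negligible against the order `n ^ (3 / 2)` of the linear part. -/
theorem integral_sq_sum_degenerate_le (hindep : iIndepFun U P) (hlaw : ∀ n, HasLaw (U n) μ P)
    {ρ : S → S → ℝ} (hρ : Measurable (Function.uncurry ρ)) {M : ℝ} (hM : ∀ x y, |ρ x y| ≤ M)
    (h1 : ∀ x, ∫ y, ρ x y ∂μ = 0) (h2 : ∀ y, ∫ x, ρ x y ∂μ = 0) (n : ℕ) :
    ∫ ω, (∑ p ∈ (Finset.range n).offDiag, ρ (U p.1 ω) (U p.2 ω)) ^ 2 ∂P ≤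
      2 * M ^ 2 * (n * (n - 1)) := by
  have hM0 (x y z w : S) : |ρ x y * ρ z w| ≤ M * M := by
    rw [abs_mul]
    exact mul_le_mul (hM _ _) (hM _ _) (abs_nonneg _) ((abs_nonneg _).trans (hM x y))
  have hmeas (a b : ℕ) : AEMeasurable (fun ω => ρ (U a ω) (U b ω)) P :=
    hρ.comp_aemeasurable ((hlaw a).aemeasurable.prodMk (hlaw b).aemeasurable)
  have hint (p q : ℕ × ℕ) :
      Integrable (fun ω => ρ (U p.1 ω) (U p.2 ω) * ρ (U q.1 ω) (U q.2 ω)) P :=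
    Integrable.of_bound ((hmeas _ _).mul (hmeas _ _)).aestronglyMeasurable (M * M)
      (ae_of_all _ fun _ => hM0 _ _ _ _)
  have hcov (p q : ℕ × ℕ) :
      ∫ ω, ρ (U p.1 ω) (U p.2 ω) * ρ (U q.1 ω) (U q.2 ω) ∂P ≤ M ^ 2 := by
    refine (integral_mono (hint p q) (integrable_const (M ^ 2)) fun ω => ?_).trans_eq (by simp)
    exact (le_abs_self _).trans ((hM0 _ _ _ _).trans_eq (by ring))
  simp_rw [sq (Finset.sum _ _), Finset.sum_mul_sum]
  rw [integral_finsetSum _ fun p _ => integrable_finsetSum _ fun q _ => hint p q]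
  have hrow (p : ℕ × ℕ) (hp : p ∈ (Finset.range n).offDiag) :
      ∫ ω, ∑ q ∈ (Finset.range n).offDiag,
        ρ (U p.1 ω) (U p.2 ω) * ρ (U q.1 ω) (U q.2 ω) ∂P ≤ 2 * M ^ 2 := by
    have hp' := Finset.mem_offDiag.1 hp
    rw [integral_finsetSum _ fun q _ => hint p q]
    have hsub : ({p, p.swap} : Finset (ℕ × ℕ)) ⊆ (Finset.range n).offDiag := by
      intro q hq
      simp only [Finset.mem_insert, Finset.mem_singleton] at hq
      rcases hq with rfl | rfl
      · exact hp
      · exact Finset.mem_offDiag.2 ⟨hp'.2.1, hp'.1, hp'.2.2.symm⟩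
    rw [← Finset.sum_subset hsub]
    · have hne : p ∉ ({p.swap} : Finset (ℕ × ℕ)) := by
        rw [Finset.mem_singleton]
        intro h
        exact hp'.2.2 (congrArg Prod.fst h)
      rw [Finset.sum_insert hne, Finset.sum_singleton]
      linarith [hcov p p, hcov p p.swap]
    · intro q _ hq
      simp only [Finset.mem_insert, Finset.mem_singleton, not_or] at hq
      exact integral_degenerate_mul_eq_zero hindep hlaw hρ hM h1 h2 hp'.2.2 hq.1 hq.2
  refine (Finset.sum_le_sum hrow).trans_eq ?_
  rw [Finset.sum_const, Finset.offDiag_card, Finset.card_range, nsmul_eq_mul,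
    Nat.cast_sub (Nat.le_mul_self n)]
  push_cast
  ring

theorem sum_offDiag_fst_add_snd (n : ℕ) (f g : ℕ → ℝ) :
    ∑ p ∈ (Finset.range n).offDiag, (f p.1 + g p.2) =
      ((n : ℝ) - 1) * ∑ k ∈ Finset.range n, (f k + g k) := by
  have h := Finset.sum_union (f := fun p : ℕ × ℕ => f p.1 + g p.2)
    (Finset.disjoint_diag_offDiag (Finset.range n))
  rw [Finset.diag_union_offDiag, Finset.sum_product, Finset.sum_diag] at h
  simp only [Finset.sum_add_distrib, Finset.sum_const, Finset.card_range, nsmul_eq_mul,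
    ← Finset.mul_sum] at h ⊢
  linarith

/-- Hoeffding's central limit theorem for a U-statistic of order two with a bounded kernel `h`, not
necessarily symmetric. The centering is `∫∫ h`, written as half the mean of the sum of the two
projections of `h`. -/
theorem tendstoInDistribution_uStatistic {Ω' : Type*} [MeasurableSpace Ω'] {P' : Measure Ω'}
    [IsProbabilityMeasure P'] (hindep : iIndepFun U P) (hlaw : ∀ n, HasLaw (U n) μ P)
    {h : S → S → ℝ} (hh : Measurable (Function.uncurry h)) {M : ℝ} (hM : ∀ x y, |h x y| ≤ M)
    {Y : Ω' → ℝ} (hY : HasLaw Y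
      (gaussianReal 0 (Var[fun x => ∫ y, h x y ∂μ + ∫ y, h y x ∂μ; μ]).toNNReal) P') :
    TendstoInDistribution
      (fun (n : ℕ) ω => √n * (((n : ℝ) * ((n : ℝ) - 1))⁻¹ *
        ∑ p ∈ (Finset.range n).offDiag, h (U p.1 ω) (U p.2 ω) -
          (∫ x, ∫ y, h x y ∂μ + ∫ y, h y x ∂μ ∂μ) / 2))
      atTop Y (fun _ => P) P' := by
  have hμ : IsProbabilityMeasure μ := (hlaw 0).isProbabilityMeasure_iff.1 ‹_›
  have hh' : Measurable (Function.uncurry fun x y => h y x) := hh.comp measurable_swap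
  have hix (x : S) : Integrable (h x) μ :=
    Integrable.of_bound (hh.comp measurable_prodMk_left).aestronglyMeasurable M
      (ae_of_all _ (hM x))
  have hiy (y : S) : Integrable (fun x => h x y) μ :=
    Integrable.of_bound (hh.comp measurable_prodMk_right).aestronglyMeasurable M
      (ae_of_all _ fun x => hM x y)
  set h1 : S → ℝ := fun x => ∫ y, h x y ∂μ with h1_def
  set h2 : S → ℝ := fun x => ∫ y, h y x ∂μ with h2_def
  have m1 : Measurable h1 := hh.stronglyMeasurable.integral_prod_right.measurable
  have m2 : Measurable h2 := hh'.stronglyMeasurable.integral_prod_right.measurable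
  have b1 (x : S) : |h1 x| ≤ M := by
    simpa using norm_integral_le_of_norm_le_const (μ := μ) (f := h x) (ae_of_all _ (hM x))
  have b2 (x : S) : |h2 x| ≤ M := by
    simpa using norm_integral_le_of_norm_le_const (μ := μ) (f := fun y => h y x)
      (ae_of_all _ fun y => hM y x)
  have i1 : Integrable h1 μ := Integrable.of_bound m1.aestronglyMeasurable M (ae_of_all _ b1)
  have i2 : Integrable h2 μ := Integrable.of_bound m2.aestronglyMeasurable M (ae_of_all _ b2)
  set θ : ℝ := ∫ x, h1 x ∂μ with hθ
  have hθ2 : ∫ x, h2 x ∂μ = θ :=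
    integral_integral_swap (f := fun x y => h y x)
      (Integrable.of_bound hh'.aestronglyMeasurable M (ae_of_all _ fun p => hM _ _))
  have hsum : ∫ x, h1 x + h2 x ∂μ = 2 * θ := by
    rw [integral_add i1 i2, hθ2]
    ring
  rw [hsum]
  -- The degenerate part of the Hoeffding decomposition of `h`.
  set ρ : S → S → ℝ := fun x y => h x y - h1 x - h2 y + θ with hρ_def
  have hρ : Measurable (Function.uncurry ρ) :=
    ((hh.sub (m1.comp measurable_fst)).sub (m2.comp measurable_snd)).add_const θ
  have bθ : |θ| ≤ M := by
    simpa using norm_integral_le_of_norm_le_const (μ := μ) (f := h1) (ae_of_all _ b1)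
  have bρ (x y : S) : |ρ x y| ≤ 4 * M := by
    have e1 := abs_le.1 (hM x y)
    have e2 := abs_le.1 (b1 x)
    have e3 := abs_le.1 (b2 y)
    have e4 := abs_le.1 bθ
    rw [abs_le]
    constructor <;> simp only [hρ_def] <;> linarith
  have d1 (x : S) : ∫ y, ρ x y ∂μ = 0 := by
    simp only [hρ_def]
    have j : Integrable (fun y => h x y - h1 x) μ := (hix x).sub (integrable_const _)
    have k : Integrable (fun y => h x y - h1 x - h2 y) μ := j.sub i2
    rw [integral_add k (integrable_const _), integral_sub j i2,
      integral_sub (hix x) (integrable_const _), hθ2]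
    simp [h1_def]
  have d2 (y : S) : ∫ x, ρ x y ∂μ = 0 := by
    simp only [hρ_def]
    have j : Integrable (fun x => h x y - h1 x) μ := (hiy y).sub i1
    have k : Integrable (fun x => h x y - h1 x - h2 y) μ := j.sub (integrable_const _)
    rw [integral_add k (integrable_const _), integral_sub j (integrable_const _),
      integral_sub (hiy y) i1, ← hθ]
    simp [h2_def]
  have hUm (n : ℕ) := (hlaw n).aemeasurable
  -- The linear part is a sum of independent variables, to which the classical theorem applies.
  have clt := tendstoInDistribution_inv_sqrt_mul_sum_sub (P := P) (P' := P') (Y := Y)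
    (X := fun n ω => h1 (U n ω) + h2 (U n ω)) (by
      have hv : Var[fun ω => h1 (U 0 ω) + h2 (U 0 ω); P] = Var[fun x => h1 x + h2 x; μ] := by
        rw [← (hlaw 0).map_eq, variance_map (by fun_prop) (hUm 0)]
        rfl
      rw [hv]
      exact hY)
    (MemLp.of_bound (by fun_prop) (M + M)
      (ae_of_all _ fun ω => (abs_add_le _ _).trans (add_le_add (b1 _) (b2 _))))
    (hindep.comp (fun _ x => h1 x + h2 x) (fun _ => by fun_prop))
    (fun n => (⟨hUm n, hUm 0, by rw [(hlaw n).map_eq, (hlaw 0).map_eq]⟩ :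
      IdentDistrib (U n) (U 0) P P).comp (u := fun x => h1 x + h2 x) (by fun_prop))
  have hmean : ∫ ω, h1 (U 0 ω) + h2 (U 0 ω) ∂P = 2 * θ := by
    rw [← hsum]
    exact (hlaw 0).integral_comp (f := fun x => h1 x + h2 x) (by fun_prop)
  simp only [hmean] at clt
  have hDm (n : ℕ) : AEMeasurable
      (fun ω => ∑ p ∈ (Finset.range n).offDiag, ρ (U p.1 ω) (U p.2 ω)) P :=
    Finset.aemeasurable_fun_sum _ fun p _ => hρ.comp_aemeasurable ((hUm _).prodMk (hUm _))
  refine tendstoInDistribution_of_tendstoInMeasure_sub _ _ clt ?_ fun n => ?_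
  · have hR : TendstoInMeasure P (fun (n : ℕ) ω => √n * (((n : ℝ) * ((n : ℝ) - 1))⁻¹ *
        ∑ p ∈ (Finset.range n).offDiag, ρ (U p.1 ω) (U p.2 ω))) atTop 0 := by
      refine tendstoInMeasure_zero_of_tendsto_integral_sq (fun n => ?_) ?_
      · refine Integrable.of_bound
          ((((hDm n).const_mul _).const_mul _).pow_const 2).aestronglyMeasurable
          ((√n * (((n : ℝ) * ((n : ℝ) - 1))⁻¹ * ∑ p ∈ (Finset.range n).offDiag, 4 * M)) ^ 2)
          (ae_of_all _ fun ω => ?_)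
        rw [norm_pow, Real.norm_eq_abs, sq_le_sq, abs_abs, abs_mul, abs_mul, abs_mul, abs_mul]
        refine mul_le_mul_of_nonneg_left
          (mul_le_mul_of_nonneg_left ?_ (abs_nonneg _)) (abs_nonneg _)
        exact (Finset.abs_sum_le_sum_abs _ _).trans
          ((Finset.sum_le_sum fun p _ => bρ _ _).trans (le_abs_self _))
      · have hlim : Tendsto (fun n : ℕ => 2 * (4 * M) ^ 2 * ((n : ℝ) - 1)⁻¹) atTop (𝓝 0) := by
          have : Tendsto (fun n : ℕ => (n : ℝ) - 1) atTop atTop :=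
            tendsto_atTop_add_const_right _ _ tendsto_natCast_atTop_atTop
          simpa using (tendsto_inv_atTop_zero.comp this).const_mul (2 * (4 * M) ^ 2)
        refine tendsto_of_tendsto_of_tendsto_of_le_of_le' tendsto_const_nhds hlim
          (Eventually.of_forall fun n => integral_nonneg fun ω => sq_nonneg _) ?_
        filter_upwards [eventually_ge_atTop 2] with n hn
        have hn' : (2 : ℝ) ≤ n := by exact_mod_cast hn
        have hn1 : (n : ℝ) - 1 ≠ 0 := by linarith
        simp_rw [mul_pow, integral_const_mul]
        rw [Real.sq_sqrt (by linarith)]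
        have hb := integral_sq_sum_degenerate_le hindep hlaw hρ bρ d1 d2 n
        calc (n : ℝ) * (((n : ℝ) * ((n : ℝ) - 1))⁻¹ ^ 2 * _)
            ≤ n * (((n : ℝ) * ((n : ℝ) - 1))⁻¹ ^ 2 *
              (2 * (4 * M) ^ 2 * (n * ((n : ℝ) - 1)))) := by gcongr
          _ = 2 * (4 ^ 2 * M ^ 2) * ((n : ℝ) - 1)⁻¹ := by
            field_simp
    refine hR.congr' ?_ (by rfl)
    filter_upwards [eventually_ge_atTop 2] with n hn
    refine ae_of_all _ fun ω => ?_
    have hn' : (2 : ℝ) ≤ n := by exact_mod_cast hn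
    have hdec : ∑ p ∈ (Finset.range n).offDiag, ρ (U p.1 ω) (U p.2 ω) =
        ∑ p ∈ (Finset.range n).offDiag, h (U p.1 ω) (U p.2 ω) -
          ((n : ℝ) - 1) * ∑ k ∈ Finset.range n, (h1 (U k ω) + h2 (U k ω)) +
          n * (n - 1) * θ := by
      rw [← sum_offDiag_fst_add_snd n (fun k => h1 (U k ω)) (fun k => h2 (U k ω)),
        ← Finset.sum_sub_distrib]
      have hcard : (n : ℝ) * (n - 1) * θ = ∑ p ∈ (Finset.range n).offDiag, θ := by
        rw [Finset.sum_const, Finset.offDiag_card, Finset.card_range, nsmul_eq_mul,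
          Nat.cast_sub (Nat.le_mul_self n)]
        push_cast
        ring
      rw [hcard, ← Finset.sum_add_distrib]
      exact Finset.sum_congr rfl fun p _ => by simp only [hρ_def]; ring
    simp only [Pi.sub_apply]
    rw [hdec]
    obtain ⟨s, hs, hsn⟩ : ∃ s : ℝ, 0 < s ∧ (n : ℝ) = s ^ 2 :=
      ⟨√n, Real.sqrt_pos.2 (by linarith), (Real.sq_sqrt (by linarith)).symm⟩
    have h1n : s ^ 2 - 1 ≠ 0 := by rw [← hsn]; linarith
    rw [hsn, Real.sqrt_sq hs.le]
    field_simp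
    ring
  · refine AEMeasurable.const_mul (AEMeasurable.sub_const (AEMeasurable.const_mul ?_ _) _) _
    exact Finset.aemeasurable_fun_sum _ fun p _ =>
      hh.comp_aemeasurable ((hUm _).prodMk (hUm _))

end UStatistic

/-! ### The copula sample and the projections of the concordance kernel -/

/-- A continuous distribution function `F` of `Y` makes `F(Y)` atomless: a compact subset of a level
set of `F` lies in an interval on which `F` does not increase. -/
theorem measure_cdf_preimage_singleton {m : Measure ℝ} [IsProbabilityMeasure m]
    (hm : Continuous (cdf m)) (u : ℝ) : m (cdf m ⁻¹' {u}) = 0 := by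
  have hatom (a : ℝ) : m {a} = 0 := by
    rw [← measure_cdf m, StieltjesFunction.measure_singleton,
      (hm.continuousWithinAt).leftLim_eq]
    simp
  rw [((isClosed_singleton.preimage hm).measurableSet).measure_eq_iSup_isCompact]
  simp only [ENNReal.iSup_eq_zero]
  intro K hK hKc
  rcases K.eq_empty_or_nonempty with rfl | hne
  · simp
  have ha := hK (hKc.sInf_mem hne)
  have hb := hK (hKc.sSup_mem hne)
  have hsub : K ⊆ Set.Icc (sInf K) (sSup K) := fun x hx =>
    ⟨csInf_le hKc.bddBelow hx, le_csSup hKc.bddAbove hx⟩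
  refine measure_mono_null hsub ?_
  rw [← measure_cdf m, StieltjesFunction.measure_Icc, (hm.continuousWithinAt).leftLim_eq, ha, hb]
  simp

section Copula

variable {d : ℕ} {ν : Measure (Fin d → ℝ)}

theorem measurable_probTransform : Measurable (probTransform ν) :=
  measurable_pi_lambda _ fun j => (monotone_cdf _).measurable.comp (measurable_pi_apply j)

instance isProbabilityMeasure_copulaLaw [IsProbabilityMeasure ν] :
    IsProbabilityMeasure (copulaLaw ν) :=
  Measure.isProbabilityMeasure_map measurable_probTransform.aemeasurable

theorem copulaLaw_eval_eq_zero [IsProbabilityMeasure ν]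
    (hcont : ∀ j, Continuous (cdf (ν.map (fun x => x j))))
    (j : Fin d) (u : ℝ) : copulaLaw ν {w | w j = u} = 0 := by
  have : IsProbabilityMeasure (ν.map fun x => x j) :=
    Measure.isProbabilityMeasure_map (measurable_pi_apply j).aemeasurable
  have h := measure_cdf_preimage_singleton (hcont j) u
  rw [Measure.map_apply (measurable_pi_apply j)
    ((hcont j).measurable (measurableSet_singleton u))] at h
  exact (Measure.map_apply measurable_probTransform
    (measurable_pi_apply j (measurableSet_singleton u))).trans h

variable {Ω : Type*} [MeasurableSpace Ω] {P : Measure Ω} {X : ℕ → Ω → Fin d → ℝ}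

theorem hasLaw_probTransform {Y : Ω → Fin d → ℝ} (hY : HasLaw Y ν P) :
    HasLaw (fun ω => probTransform ν (Y ω)) (copulaLaw ν) P :=
  (⟨measurable_probTransform.aemeasurable, rfl⟩ :
    HasLaw (probTransform ν) (copulaLaw ν) ν).fun_comp hY

theorem ae_probTransform_ne [IsProbabilityMeasure ν]
    (hcont : ∀ j, Continuous (cdf (ν.map (fun x => x j))))
    (hindep : iIndepFun X P) (hlaw : ∀ n, HasLaw (X n) ν P) {r s : ℕ} (hrs : r ≠ s)
    (j : Fin d) :
    ∀ᵐ ω ∂P, probTransform ν (X r ω) j ≠ probTransform ν (X s ω) j := by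
  have := (hlaw r).isProbabilityMeasure
  have hr := hasLaw_probTransform (hlaw r)
  have hs := hasLaw_probTransform (hlaw s)
  have hi : IndepFun (fun ω => probTransform ν (X r ω)) (fun ω => probTransform ν (X s ω)) P :=
    (hindep.indepFun hrs).comp measurable_probTransform measurable_probTransform
  have hmap := (indepFun_iff_map_prod_eq_prod_map_map hr.aemeasurable hs.aemeasurable).1 hi
  rw [hr.map_eq, hs.map_eq] at hmap
  have hms : MeasurableSet {p : (Fin d → ℝ) × (Fin d → ℝ) | p.1 j ≠ p.2 j} :=
    (measurableSet_eq_fun (by fun_prop) (by fun_prop)).compl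
  have hprod : ∀ᵐ p ∂(copulaLaw ν).prod (copulaLaw ν), p.1 j ≠ p.2 j := by
    rw [Measure.ae_prod_iff_ae_ae hms]
    refine ae_of_all _ fun x => ?_
    have := copulaLaw_eval_eq_zero hcont j (x j)
    rw [ae_iff]
    simpa [eq_comm] using this
  rw [← hmap] at hprod
  exact (ae_map_iff (hr.aemeasurable.prodMk hs.aemeasurable) hms).1 hprod

/-- The rank statistic `τ̂` only depends on the order of the observations in each coordinate, which
the marginal distribution functions preserve almost surely: it may be computed from the copula
sample. -/
theorem tauHat_probTransform_ae_eq [IsProbabilityMeasure ν]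
    (hcont : ∀ j, Continuous (cdf (ν.map (fun x => x j))))
    (hindep : iIndepFun X P) (hlaw : ∀ n, HasLaw (X n) ν P) :
    ∀ᵐ ω ∂P, ∀ n, tauHat n (fun k => probTransform ν (X k ω)) = tauHat n (fun k => X k ω) := by
  have hne : ∀ᵐ ω ∂P, ∀ r s j, r ≠ s →
      probTransform ν (X r ω) j ≠ probTransform ν (X s ω) j := by
    simp only [ae_all_iff]
    exact fun r s j hrs => ae_probTransform_ne hcont hindep hlaw hrs j
  filter_upwards [hne] with ω hω n
  have hiff (r s : ℕ) (hrs : r ≠ s) (j : Fin d) :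
      probTransform ν (X r ω) j ≤ probTransform ν (X s ω) j ↔ X r ω j ≤ X s ω j := by
    refine ⟨fun h => ?_, fun h => monotone_cdf _ h⟩
    by_contra! hlt
    exact hω r s j hrs (h.antisymm (monotone_cdf _ hlt.le))
  funext q
  simp only [tauHat, empiricalTau]
  congr 2
  refine Finset.sum_congr rfl fun r _ => Finset.sum_congr rfl fun s _ => ?_
  by_cases hrs : r = s
  · simp [hrs]
  · simp only [hiff r s hrs]

/-- The indicator that the observation `x` is dominated by `y` in the coordinates `i` and `j`. -/
noncomputable def concordance (i j : Fin d) (x y : Fin d → ℝ) : ℝ :=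
  if x i ≤ y i ∧ x j ≤ y j then 1 else 0

theorem concordance_eq_indicator (i j : Fin d) (x y : Fin d → ℝ) :
    concordance i j x y =
      {p : (Fin d → ℝ) × (Fin d → ℝ) | p.1 i ≤ p.2 i ∧ p.1 j ≤ p.2 j}.indicator 1 (x, y) := by
  simp [concordance, Set.indicator_apply]

theorem measurableSet_concordance (i j : Fin d) :
    MeasurableSet {p : (Fin d → ℝ) × (Fin d → ℝ) | p.1 i ≤ p.2 i ∧ p.1 j ≤ p.2 j} :=
  (measurableSet_le (f := fun p : (Fin d → ℝ) × (Fin d → ℝ) => p.1 i) (g := fun p => p.2 i)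
    (by fun_prop) (by fun_prop)).inter
  (measurableSet_le (f := fun p : (Fin d → ℝ) × (Fin d → ℝ) => p.1 j) (g := fun p => p.2 j)
    (by fun_prop) (by fun_prop))

theorem measurable_concordance (i j : Fin d) :
    Measurable (Function.uncurry (concordance i j)) := by
  have : Function.uncurry (concordance i j) =
      {p : (Fin d → ℝ) × (Fin d → ℝ) | p.1 i ≤ p.2 i ∧ p.1 j ≤ p.2 j}.indicator 1 := by
    funext p
    exact concordance_eq_indicator i j p.1 p.2
  rw [this]
  exact measurable_one.indicator (measurableSet_concordance i j)

theorem abs_concordance_le_one (i j : Fin d) (x y : Fin d → ℝ) : |concordance i j x y| ≤ 1 := by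
  unfold concordance
  split_ifs <;> simp

/-- The sum `C_{ij}(u_i, u_j) + C̄_{ij}(u_i, u_j)` of the bivariate copula and of its survival
function. -/
noncomputable def copulaSum (ν : Measure (Fin d → ℝ)) (i j : Fin d) (u : Fin d → ℝ) : ℝ :=
  copula₂ ν i j (u i) (u j) + copulaSurvival₂ ν i j (u i) (u j)

theorem integral_concordance_right [IsProbabilityMeasure ν]
    (hcont : ∀ j, Continuous (cdf (ν.map (fun x => x j))))
    (i j : Fin d) (u : Fin d → ℝ) :
    ∫ y, concordance i j u y ∂copulaLaw ν = copulaSurvival₂ ν i j (u i) (u j) := by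
  have hms : MeasurableSet {y : Fin d → ℝ | u i ≤ y i ∧ u j ≤ y j} :=
    measurable_prodMk_left (x := u) (measurableSet_concordance i j)
  have h1 : (fun y => concordance i j u y) =
      {y : Fin d → ℝ | u i ≤ y i ∧ u j ≤ y j}.indicator 1 := by
    funext y
    simp [concordance, Set.indicator_apply]
  rw [h1, integral_indicator_one hms, copulaSurvival₂]
  refine measureReal_congr ?_
  have hn (k : Fin d) : ∀ᵐ w ∂copulaLaw ν, w k ≠ u k := by
    rw [ae_iff]
    simpa using copulaLaw_eval_eq_zero hcont k (u k)
  filter_upwards [hn i, hn j] with w hi hj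
  exact propext (and_congr ⟨fun h => lt_of_le_of_ne h hi.symm, le_of_lt⟩
    ⟨fun h => lt_of_le_of_ne h hj.symm, le_of_lt⟩)

theorem integral_concordance_left (i j : Fin d) (u : Fin d → ℝ) :
    ∫ y, concordance i j y u ∂copulaLaw ν = copula₂ ν i j (u i) (u j) := by
  have hms : MeasurableSet {y : Fin d → ℝ | y i ≤ u i ∧ y j ≤ u j} :=
    measurable_prodMk_right (y := u) (measurableSet_concordance i j)
  have h1 : (fun y => concordance i j y u) =
      {y : Fin d → ℝ | y i ≤ u i ∧ y j ≤ u j}.indicator 1 := by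
    funext y
    simp [concordance, Set.indicator_apply]
  rw [h1, integral_indicator_one hms, copula₂]

theorem integral_concordance_add [IsProbabilityMeasure ν]
    (hcont : ∀ j, Continuous (cdf (ν.map (fun x => x j))))
    (i j : Fin d) (u : Fin d → ℝ) :
    ∫ y, concordance i j u y ∂copulaLaw ν + ∫ y, concordance i j y u ∂copulaLaw ν =
      copulaSum ν i j u := by
  rw [integral_concordance_right hcont, integral_concordance_left, copulaSum, add_comm]

theorem tauHat_eq_sum_concordance (n : ℕ) (x : ℕ → Fin d → ℝ) (q : PairIdx d) :
    tauHat n x q = -1 + 4 * (((n : ℝ) * ((n : ℝ) - 1))⁻¹ *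
      ∑ p ∈ (Finset.range n).offDiag, concordance q.1.1 q.1.2 (x p.1) (x p.2)) := by
  rw [tauHat, empiricalTau, div_eq_mul_inv, mul_assoc]
  congr 3
  rw [← Finset.sum_product', ← Finset.sum_subset fun p hp => Finset.mem_product.2
    ⟨(Finset.mem_offDiag.1 hp).1, (Finset.mem_offDiag.1 hp).2.1⟩]
  · refine Finset.sum_congr rfl fun p hp => ?_
    simp [concordance, (Finset.mem_offDiag.1 hp).2.2]
  · intro p hp hp'
    have : p.1 = p.2 := by
      by_contra hne
      exact hp' (Finset.mem_offDiag.2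
        ⟨(Finset.mem_product.1 hp).1, (Finset.mem_product.1 hp).2, hne⟩)
    simp [this]

end Copula

/-! ### Whitening a projection -/

/-- If `Q` is the orthogonal projection onto a subspace of dimension `k` that is invariant under a
positive definite matrix `S`, then `Q = S Aᵀ A` where the `k` rows of `A` are orthonormal for
`S`: the rows are the eigenvectors of `Q S⁻¹` for its nonzero eigenvalues, scaled by the square
roots of these. -/
theorem exists_mul_mul_transpose_eq_one {n : Type*} [Fintype n] [DecidableEq n]
    {S Q : Matrix n n ℝ} (hS : S.PosDef) (hQt : Qᵀ = Q) (hQQ : Q * Q = Q)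
    (hcomm : Q * S = S * Q) {k : ℕ} (hk : Q.rank = k) :
    ∃ A : Matrix (Fin k) n ℝ, A * S * Aᵀ = 1 ∧ S * Aᵀ * A = Q := by
  have hSu : IsUnit S.det := (Matrix.isUnit_iff_isUnit_det _).1 hS.isUnit
  have hSS : S * S⁻¹ = 1 := Matrix.mul_nonsing_inv S hSu
  have hSS' : S⁻¹ * S = 1 := Matrix.nonsing_inv_mul S hSu
  have hcomm' : S⁻¹ * Q = Q * S⁻¹ := by
    calc S⁻¹ * Q = S⁻¹ * (Q * S) * S⁻¹ := by simp only [Matrix.mul_assoc, hSS, Matrix.mul_one]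
      _ = Q * S⁻¹ := by rw [hcomm, ← Matrix.mul_assoc, hSS', Matrix.one_mul]
  set M : Matrix n n ℝ := Q * S⁻¹ with hMdef
  have hMpsd : M.PosSemidef := by
    have h := hS.inv.posSemidef.conjTranspose_mul_mul_same Q
    rw [Matrix.conjTranspose_eq_transpose_of_trivial, hQt, Matrix.mul_assoc, hcomm',
      ← Matrix.mul_assoc, hQQ] at h
    exact h
  have hSM : S * M = Q := by
    rw [hMdef, ← Matrix.mul_assoc, ← hcomm, Matrix.mul_assoc, hSS, Matrix.mul_one]
  have hMSM : M * S * M = M := by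
    rw [Matrix.mul_assoc, hSM, hMdef, Matrix.mul_assoc, hcomm', ← Matrix.mul_assoc, hQQ]
  have hrank : M.rank = k := by
    rw [← hk, hMdef, Matrix.rank_mul_eq_left_of_isUnit_det]
    rw [Matrix.det_nonsing_inv]
    exact hSu.ringInverse
  have hH := hMpsd.isHermitian
  set ev := hH.eigenvalues with hev
  set V : Matrix n n ℝ := (hH.eigenvectorUnitary : Matrix n n ℝ) with hV
  have hVV : Vᵀ * V = 1 := by
    have := Matrix.mem_unitaryGroup_iff'.1 hH.eigenvectorUnitary.2
    simpa [Matrix.star_eq_conjTranspose, Matrix.conjTranspose_eq_transpose_of_trivial] using this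
  have hspec : M = V * Matrix.diagonal ev * Vᵀ := by
    have h := hH.spectral_theorem
    rw [Unitary.conjStarAlgAut_apply, Matrix.star_eq_conjTranspose,
      Matrix.conjTranspose_eq_transpose_of_trivial] at h
    exact h
  have hnn (i : n) : 0 ≤ ev i := hMpsd.eigenvalues_nonneg i
  have hcard : Fintype.card {i // ev i ≠ 0} = k := by
    rw [← hrank, hH.rank_eq_card_non_zero_eigs]
  let e : Fin k ≃ {i // ev i ≠ 0} := (Fintype.equivFinOfCardEq hcard).symm
  let A : Matrix (Fin k) n ℝ := Matrix.of fun a j => √(ev (e a)) * V j (e a)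
  have hAA : Aᵀ * A = M := by
    ext i j
    have h1 : (V * Matrix.diagonal ev * Vᵀ) i j = ∑ l, ev l * (V i l * V j l) := by
      rw [Matrix.mul_apply]
      refine Finset.sum_congr rfl fun l _ => ?_
      rw [Matrix.mul_diagonal, Matrix.transpose_apply]
      ring
    have h2 : (Aᵀ * A) i j = ∑ l : {i // ev i ≠ 0}, ev l * (V i l * V j l) := by
      rw [← e.sum_comp, Matrix.mul_apply]
      refine Finset.sum_congr rfl fun a _ => ?_
      simp only [A, Matrix.transpose_apply, Matrix.of_apply]
      rw [mul_mul_mul_comm, Real.mul_self_sqrt (hnn _)]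
    rw [h2, hspec, h1, ← Finset.sum_subtype (Finset.univ.filter fun l => ev l ≠ 0) (by simp)
      (fun l => ev l * (V i l * V j l))]
    refine Finset.sum_subset (Finset.filter_subset _ _) fun l _ hl => ?_
    have : ev l = 0 := by simpa using hl
    rw [this, zero_mul]
  have hD : Matrix.diagonal ev * (Vᵀ * S * V) * Matrix.diagonal ev = Matrix.diagonal ev := by
    calc Matrix.diagonal ev * (Vᵀ * S * V) * Matrix.diagonal ev
        = (Vᵀ * V) * Matrix.diagonal ev * (Vᵀ * S * V) * Matrix.diagonal ev * (Vᵀ * V) := by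
          rw [hVV, Matrix.mul_one, Matrix.one_mul]
      _ = Vᵀ * (M * S * M) * V := by
          rw [hspec]
          simp only [Matrix.mul_assoc]
      _ = (Vᵀ * V) * Matrix.diagonal ev * (Vᵀ * V) := by
          rw [hMSM, hspec]
          simp only [Matrix.mul_assoc]
      _ = Matrix.diagonal ev := by rw [hVV, Matrix.mul_one, Matrix.one_mul]
  refine ⟨A, ?_, by rw [Matrix.mul_assoc, hAA, hSM]⟩
  have hAV (a b : Fin k) : (A * S * Aᵀ) a b =
      √(ev (e a)) * (Vᵀ * S * V) (e a) (e b) * √(ev (e b)) := by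
    simp only [Matrix.mul_apply, A, Matrix.of_apply, Matrix.transpose_apply, Finset.sum_mul,
      Finset.mul_sum]
    refine Finset.sum_congr rfl fun i _ => Finset.sum_congr rfl fun j _ => ?_
    ring
  ext a b
  have hab := congrFun (congrFun hD (e a)) (e b)
  rw [Matrix.mul_diagonal, Matrix.diagonal_mul] at hab
  have ha : 0 < ev (e a) := lt_of_le_of_ne (hnn _) (e a).2.symm
  have hb : 0 < ev (e b) := lt_of_le_of_ne (hnn _) (e b).2.symm
  rw [hAV]
  by_cases h : a = b
  · subst h
    rw [Matrix.diagonal_apply_eq] at hab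
    have h1 : ev (e a) * (Vᵀ * S * V) (e a) (e a) = 1 :=
      mul_right_cancel₀ hb.ne' (by rw [hab, one_mul])
    rw [Matrix.one_apply_eq, mul_right_comm, Real.mul_self_sqrt ha.le, h1]
  · have hne : (e a : n) ≠ e b := fun h' => h (e.injective (Subtype.ext h'))
    rw [Matrix.diagonal_apply_ne _ hne] at hab
    have h1 : (Vᵀ * S * V) (e a) (e b) = 0 := by
      simpa [ha.ne', hb.ne'] using hab
    rw [h1, Matrix.one_apply_ne h]
    simp

theorem rank_one_sub_of_isIdempotentElem {n : Type*} [Fintype n] [DecidableEq n]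
    {Γ : Matrix n n ℝ} (h : Γ * Γ = Γ) : (1 - Γ).rank = Fintype.card n - Γ.rank := by
  have hker : LinearMap.range (1 - Γ).mulVecLin = LinearMap.ker Γ.mulVecLin := by
    ext v
    simp only [LinearMap.mem_range, LinearMap.mem_ker, Matrix.mulVecLin_apply]
    constructor
    · rintro ⟨w, rfl⟩
      rw [Matrix.mulVec_mulVec, Matrix.mul_sub, h, Matrix.mul_one, sub_self, Matrix.zero_mulVec]
    · intro hv
      exact ⟨v, by rw [Matrix.sub_mulVec, hv, Matrix.one_mulVec, sub_zero]⟩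
  have hr := LinearMap.finrank_range_add_finrank_ker Γ.mulVecLin
  rw [Module.finrank_fintype_fun_eq_card] at hr
  rw [Matrix.rank, hker, Matrix.rank]
  omega

/-! ### Blocks of pairs and their number -/

theorem block_comm {d : ℕ} (A A' : Finset (Fin d)) : block A A' = block A' A := by
  ext r
  simp [block, or_comm]

/-- The block of an unordered pair of clusters. -/
def symBlock {d : ℕ} : Sym2 (Finset (Fin d)) → Finset (PairIdx d) :=
  Sym2.lift ⟨block, block_comm⟩

/-- Distinct unordered pairs of clusters give disjoint blocks. -/
theorem eq_of_mem_block {d : ℕ} {G : Finpartition (Finset.univ : Finset (Fin d))}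
    {A A' C C' : Finset (Fin d)} (hA : A ∈ G.parts) (hA' : A' ∈ G.parts) (hC : C ∈ G.parts)
    (hC' : C' ∈ G.parts) {r : PairIdx d} (hr : r ∈ block A A') (hr' : r ∈ block C C') :
    s(A, A') = s(C, C') := by
  have huniq {B D : Finset (Fin d)} (hB : B ∈ G.parts) (hD : D ∈ G.parts) {x : Fin d}
      (hx : x ∈ B) (hx' : x ∈ D) : B = D := G.eq_of_mem_parts hB hD hx hx'
  simp only [block, Finset.mem_filter, Finset.mem_univ, true_and] at hr hr'
  rcases hr with ⟨h1, h2⟩ | ⟨h1, h2⟩ <;> rcases hr' with ⟨h3, h4⟩ | ⟨h3, h4⟩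
  · rw [huniq hA hC h1 h3, huniq hA' hC' h2 h4]
  · rw [huniq hA hC' h1 h3, huniq hA' hC h2 h4, Sym2.eq_swap]
  · rw [huniq hA' hC h1 h3, huniq hA hC' h2 h4, Sym2.eq_swap]
  · rw [huniq hA' hC' h1 h3, huniq hA hC h2 h4]

theorem exists_mem_blocks {d : ℕ} (G : Finpartition (Finset.univ : Finset (Fin d)))
    (r : PairIdx d) : ∃ b ∈ blocks G, r ∈ b := by
  have hr : r ∈ block (G.part r.1.1) (G.part r.1.2) := by
    simp [block, G.mem_part (Finset.mem_univ _)]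
  refine ⟨_, ?_, hr⟩
  rw [blocks, Finset.mem_filter, Finset.mem_image]
  exact ⟨⟨(G.part r.1.1, G.part r.1.2), Finset.mem_product.2
    ⟨G.part_mem.2 (Finset.mem_univ _), G.part_mem.2 (Finset.mem_univ _)⟩, rfl⟩, ⟨r, hr⟩⟩

theorem eq_of_mem_blocks {d : ℕ} {G : Finpartition (Finset.univ : Finset (Fin d))}
    {b b' : Finset (PairIdx d)} (hb : b ∈ blocks G) (hb' : b' ∈ blocks G) {r : PairIdx d}
    (hr : r ∈ b) (hr' : r ∈ b') : b = b' := by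
  simp only [blocks, Finset.mem_filter, Finset.mem_image, Finset.mem_product, Prod.exists] at hb hb'
  obtain ⟨⟨A, A', ⟨hA, hA'⟩, rfl⟩, -⟩ := hb
  obtain ⟨⟨C, C', ⟨hC, hC'⟩, rfl⟩, -⟩ := hb'
  exact congrArg symBlock (eq_of_mem_block hA hA' hC hC' hr hr')

theorem card_pairIdx (d : ℕ) : Fintype.card (PairIdx d) = d * (d - 1) / 2 := by
  have h : (Finset.univ.filter fun e : Fin d × Fin d => e.1 < e.2).card * 2 = d * (d - 1) := by
    have h1 : (Finset.univ.filter fun e : Fin d × Fin d => e.1 < e.2).card =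
        (Finset.univ.filter fun e : Fin d × Fin d => e.2 < e.1).card :=
      Finset.card_equiv (Equiv.prodComm _ _) (by simp)
    have h2 : (Finset.univ : Finset (Fin d)).offDiag =
        (Finset.univ.filter fun e : Fin d × Fin d => e.1 < e.2) ∪
          (Finset.univ.filter fun e : Fin d × Fin d => e.2 < e.1) := by
      ext e
      simp [lt_or_lt_iff_ne]
    have h3 : Disjoint (Finset.univ.filter fun e : Fin d × Fin d => e.1 < e.2)
        (Finset.univ.filter fun e : Fin d × Fin d => e.2 < e.1) :=
      Finset.disjoint_filter.2 fun e _ h h' => lt_asymm h h'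
    have h4 := congrArg Finset.card h2
    rw [Finset.card_union_of_disjoint h3, ← h1, Finset.offDiag_card, Finset.card_univ,
      Fintype.card_fin] at h4
    rw [Nat.mul_sub_one, h4, mul_two]
  rw [Fintype.card_subtype, ← h, Nat.mul_div_cancel _ two_pos]

theorem block_nonempty_of_ne {d : ℕ} {A A' : Finset (Fin d)} {i j : Fin d} (hi : i ∈ A)
    (hj : j ∈ A') (hij : i ≠ j) : (block A A').Nonempty := by
  rcases lt_or_gt_of_ne hij with h | h
  · exact ⟨⟨(i, j), h⟩, by simp [block, hi, hj]⟩
  · exact ⟨⟨(j, i), h⟩, by simp [block, hi, hj]⟩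

/-- The blocks correspond to the unordered pairs of distinct clusters and to the clusters with at
least two elements. -/
theorem card_blocks {d : ℕ} (G : Finpartition (Finset.univ : Finset (Fin d))) :
    (blocks G).card = numBlocks G := by
  classical
  have hblocks : blocks G = ((G.parts.offDiag.image Sym2.mk.uncurry) ∪
      ((G.parts.filter fun A => 1 < A.card).image Sym2.diag)).image symBlock := by
    ext b
    simp only [blocks, Finset.mem_filter, Finset.mem_image, Finset.mem_union, Finset.mem_product,
      Finset.mem_offDiag, Prod.exists]
    constructor
    · rintro ⟨⟨A, A', ⟨hA, hA'⟩, rfl⟩, ⟨r, hr⟩⟩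
      refine ⟨s(A, A'), ?_, rfl⟩
      by_cases h : A = A'
      · subst h
        refine Or.inr ⟨A, ⟨hA, ?_⟩, rfl⟩
        simp only [block, Finset.mem_filter, Finset.mem_univ, true_and, or_self] at hr
        exact Finset.one_lt_card.2 ⟨r.1.1, hr.1, r.1.2, hr.2, r.2.ne⟩
      · exact Or.inl ⟨A, A', ⟨hA, hA', h⟩, rfl⟩
    · rintro ⟨_, ⟨A, A', ⟨hA, hA', hne⟩, rfl⟩ | ⟨A, ⟨hA, hcard⟩, rfl⟩, rfl⟩
      · refine ⟨⟨A, A', ⟨hA, hA'⟩, rfl⟩, ?_⟩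
        obtain ⟨i, hi⟩ := G.nonempty_of_mem_parts hA
        obtain ⟨j, hj⟩ := G.nonempty_of_mem_parts hA'
        refine block_nonempty_of_ne hi hj ?_
        rintro rfl
        exact hne (G.eq_of_mem_parts hA hA' hi hj)
      · refine ⟨⟨A, A, ⟨hA, hA⟩, rfl⟩, ?_⟩
        obtain ⟨i, hi, j, hj, hij⟩ := Finset.one_lt_card.1 hcard
        exact block_nonempty_of_ne hi hj hij
  have hinj : Set.InjOn (symBlock (d := d)) ((G.parts.offDiag.image Sym2.mk.uncurry) ∪
      ((G.parts.filter fun A => 1 < A.card).image Sym2.diag) : Finset (Sym2 (Finset (Fin d)))) := by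
    intro z hz z' hz' hzz
    have hne : (symBlock z).Nonempty := by
      have : symBlock z ∈ blocks G := hblocks ▸ Finset.mem_image_of_mem _ hz
      exact (Finset.mem_filter.1 this).2
    have hparts (z : Sym2 (Finset (Fin d))) (hz : z ∈ (G.parts.offDiag.image Sym2.mk.uncurry) ∪
        ((G.parts.filter fun A => 1 < A.card).image Sym2.diag)) :
        ∃ A ∈ G.parts, ∃ A' ∈ G.parts, z = s(A, A') := by
      simp only [Finset.mem_filter, Finset.mem_image, Finset.mem_union,
        Finset.mem_offDiag, Prod.exists] at hz
      rcases hz with ⟨A, A', ⟨hA, hA', -⟩, rfl⟩ | ⟨A, ⟨hA, -⟩, rfl⟩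
      · exact ⟨A, hA, A', hA', rfl⟩
      · exact ⟨A, hA, A, hA, rfl⟩
    obtain ⟨A, hA, A', hA', rfl⟩ := hparts z hz
    obtain ⟨C, hC, C', hC', rfl⟩ := hparts z' hz'
    obtain ⟨r, hr⟩ := hne
    have hr' := hr
    rw [hzz] at hr'
    exact eq_of_mem_block hA hA' hC hC' hr hr'
  have hdisj : Disjoint (G.parts.offDiag.image Sym2.mk.uncurry)
      ((G.parts.filter fun A => 1 < A.card).image Sym2.diag) := by
    rw [Finset.disjoint_left]
    intro z hz hz'
    obtain ⟨⟨A, A'⟩, hA, rfl⟩ := Finset.mem_image.1 hz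
    obtain ⟨C, -, hC⟩ := Finset.mem_image.1 hz'
    have : (s(A, A')).IsDiag := by
      change (Function.uncurry Sym2.mk (A, A')).IsDiag
      exact hC ▸ Sym2.diag_isDiag C
    exact (Finset.mem_offDiag.1 hA).2.2 this
  rw [hblocks, Finset.card_image_of_injOn hinj, Finset.card_union_of_disjoint hdisj,
    Sym2.card_image_offDiag, Finset.card_image_of_injective _ Sym2.diag_injective, numBlocks,
    Nat.choose_two_right, Finset.card_filter]

/-! ### The projection `Γ` onto the block-constant vectors -/

theorem Gam_transpose {d : ℕ} (G : Finpartition (Finset.univ : Finset (Fin d))) :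
    (Gam G)ᵀ = Gam G :=
  (moorePenrose_spec (blockMatrix G)).symm_left

theorem Gam_mul_blockMatrix {d : ℕ} (G : Finpartition (Finset.univ : Finset (Fin d))) :
    Gam G * blockMatrix G = blockMatrix G :=
  (moorePenrose_spec (blockMatrix G)).mul_mul_self

theorem Gam_mul_Gam {d : ℕ} (G : Finpartition (Finset.univ : Finset (Fin d))) :
    Gam G * Gam G = Gam G := by
  nth_rewrite 2 [Gam]
  rw [← Matrix.mul_assoc, Gam_mul_blockMatrix]
  rfl

/-- The blocks are nonempty and disjoint, so the columns of `B` are linearly independent. -/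
theorem rank_Gam {d : ℕ} (G : Finpartition (Finset.univ : Finset (Fin d))) :
    (Gam G).rank = (blocks G).card := by
  have hB : (blockMatrix G).rank = (blocks G).card := by
    have hinj : Function.Injective (blockMatrix G).mulVecLin := by
      rw [injective_iff_map_eq_zero]
      intro c hc
      funext ℓ
      obtain ⟨r, hr⟩ := (Finset.mem_filter.1 ℓ.2).2
      have := congrFun hc r
      simp only [Matrix.mulVecLin_apply, Matrix.mulVec, dotProduct, blockMatrix, Matrix.of_apply,
        Pi.zero_apply] at this
      rw [Finset.sum_eq_single ℓ] at this
      · simpa [hr] using this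
      · intro m _ hm
        have : r ∉ m.1 := fun h => hm (Subtype.ext (eq_of_mem_blocks m.2 ℓ.2 h hr))
        simp [this]
      · simp
    rw [Matrix.rank, LinearMap.finrank_range_of_inj hinj, Module.finrank_fintype_fun_eq_card,
      Fintype.card_coe]
  rw [← hB]
  refine le_antisymm (Matrix.rank_mul_le_left _ _) ?_
  conv_lhs => rw [← Gam_mul_blockMatrix]
  exact Matrix.rank_mul_le_left _ _

/-- `Γ` fixes the vectors that are constant on each block. -/
theorem Gam_mulVec_of_forall_block {d : ℕ} {G : Finpartition (Finset.univ : Finset (Fin d))}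
    {v : PairIdx d → ℝ} (hv : ∀ b ∈ blocks G, ∀ r ∈ b, ∀ s ∈ b, v r = v s) :
    Gam G *ᵥ v = v := by
  have hex (ℓ : {b // b ∈ blocks G}) : ∃ r, r ∈ ℓ.1 := (Finset.mem_filter.1 ℓ.2).2
  choose rep hrep using hex
  have hvB : v = blockMatrix G *ᵥ fun ℓ => v (rep ℓ) := by
    funext r
    obtain ⟨b, hb, hrb⟩ := exists_mem_blocks G r
    simp only [Matrix.mulVec, dotProduct, blockMatrix, Matrix.of_apply]
    rw [Finset.sum_eq_single ⟨b, hb⟩]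
    · simpa [hrb] using hv b hb r hrb _ (hrep ⟨b, hb⟩)
    · intro m _ hm
      have : r ∉ m.1 := fun h => hm (Subtype.ext (eq_of_mem_blocks m.2 hb h hrb))
      simp [this]
    · simp
  rw [hvB, Matrix.mulVec_mulVec, Gam_mul_blockMatrix]

/-- A symmetric matrix that preserves the block-constant vectors commutes with `Γ`. -/
theorem Gam_mul_comm {d : ℕ} {G : Finpartition (Finset.univ : Finset (Fin d))}
    {S : Matrix (PairIdx d) (PairIdx d) ℝ} (hS : Sᵀ = S)
    (hinv : ∀ b ∈ blocks G, ∀ r ∈ b, ∀ r' ∈ b, ∀ c ∈ blocks G,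
      ∑ s ∈ c, S r s = ∑ s ∈ c, S r' s) : Gam G * S = S * Gam G := by
  have h1 : Gam G * (S * blockMatrix G) = S * blockMatrix G := by
    ext r ℓ
    have := congrFun (Gam_mulVec_of_forall_block (G := G)
      (v := fun q => (S * blockMatrix G) q ℓ) ?_) r
    · exact this
    · intro b hb r hr r' hr'
      simpa [Matrix.mul_apply, blockMatrix, Finset.sum_ite_mem] using hinv b hb r hr r' hr' ℓ.1 ℓ.2
  have h2 : Gam G * S * Gam G = S * Gam G := by
    nth_rewrite 2 [Gam]
    rw [← Matrix.mul_assoc, Matrix.mul_assoc (Gam G), h1, Matrix.mul_assoc]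
    rfl
  have h3 := congrArg Matrix.transpose h2
  simp only [Matrix.transpose_mul, Gam_transpose, hS] at h3
  rw [← h3, ← Matrix.mul_assoc, h2]

/-! ### Partial exchangeability -/

/-- Any two pairs of the same block are exchanged, up to the order of their entries, by a
permutation that preserves the clusters. -/
theorem exists_perm_of_mem_block {d : ℕ} {G : Finpartition (Finset.univ : Finset (Fin d))}
    {A A' : Finset (Fin d)} (hA : A ∈ G.parts) (hA' : A' ∈ G.parts) {i j k l : Fin d}
    (hi : i ∈ A) (hk : k ∈ A) (hj : j ∈ A') (hl : l ∈ A') (hij : i ≠ j) (hkl : k ≠ l) :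
    ∃ π : Equiv.Perm (Fin d), (∀ B ∈ G.parts, ∀ m, m ∈ B ↔ π m ∈ B) ∧ π i = k ∧ π j = l := by
  have hswap {C : Finset (Fin d)} (hC : C ∈ G.parts) {a b : Fin d} (ha : a ∈ C) (hb : b ∈ C)
      {B : Finset (Fin d)} (hB : B ∈ G.parts) (m : Fin d) : m ∈ B ↔ Equiv.swap a b m ∈ B := by
    have hab : a ∈ B ↔ b ∈ B :=
      ⟨fun h => G.eq_of_mem_parts hC hB ha h ▸ hb, fun h => G.eq_of_mem_parts hC hB hb h ▸ ha⟩
    rw [Equiv.swap_apply_def]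
    split_ifs with h1 h2
    · rw [h1, hab]
    · rw [h2, hab]
    · rfl
  have hj' : Equiv.swap i k j ∈ A' := (hswap hA hi hk hA' j).1 hj
  have hjk : Equiv.swap i k j ≠ k := by
    intro h
    exact hij ((Equiv.swap i k).injective (h.trans (Equiv.swap_apply_left i k).symm)).symm
  refine ⟨Equiv.swap (Equiv.swap i k j) l * Equiv.swap i k, fun B hB m => ?_, ?_, ?_⟩
  · rw [Equiv.Perm.mul_apply]
    exact (hswap hA hi hk hB m).trans (hswap hA' hj' hl hB _)
  · rw [Equiv.Perm.mul_apply, Equiv.swap_apply_left, Equiv.swap_apply_of_ne_of_ne hjk.symm hkl]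
  · rw [Equiv.Perm.mul_apply, Equiv.swap_apply_left]

/-- The action of a permutation of `{1, …, d}` on the pairs `i < j`. -/
def permPair {d : ℕ} (π : Equiv.Perm (Fin d)) (r : PairIdx d) : PairIdx d :=
  if h : π r.1.1 < π r.1.2 then ⟨(π r.1.1, π r.1.2), h⟩
  else ⟨(π r.1.2, π r.1.1), lt_of_le_of_ne (not_lt.1 h) fun h' => r.2.ne (π.injective h').symm⟩

theorem permPair_injective {d : ℕ} (π : Equiv.Perm (Fin d)) :
    Function.Injective (permPair π) := by
  rintro ⟨⟨i, j⟩, hij⟩ ⟨⟨k, l⟩, hkl⟩ h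
  unfold permPair at h
  simp only at hij hkl
  split_ifs at h <;> simp only [Subtype.mk.injEq, Prod.mk.injEq, π.injective.eq_iff] at h ⊢ <;>
    first | exact h | exact h.symm | omega

theorem apply_permPair {d : ℕ} {α : Type*} {f : Fin d → Fin d → α} (hf : ∀ i j, f i j = f j i)
    (π : Equiv.Perm (Fin d)) (r : PairIdx d) :
    f (permPair π r).1.1 (permPair π r).1.2 = f (π r.1.1) (π r.1.2) := by
  unfold permPair
  split_ifs
  · rfl
  · exact hf _ _

theorem permPair_mem_iff {d : ℕ} {G : Finpartition (Finset.univ : Finset (Fin d))}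
    {π : Equiv.Perm (Fin d)} (hπ : ∀ B ∈ G.parts, ∀ m, m ∈ B ↔ π m ∈ B)
    {b : Finset (PairIdx d)} (hb : b ∈ blocks G) (r : PairIdx d) : permPair π r ∈ b ↔ r ∈ b := by
  simp only [blocks, Finset.mem_filter, Finset.mem_image, Finset.mem_product, Prod.exists] at hb
  obtain ⟨⟨A, A', ⟨hA, hA'⟩, rfl⟩, -⟩ := hb
  simp only [block, Finset.mem_filter, Finset.mem_univ, true_and]
  rw [apply_permPair (f := fun i j => (i ∈ A ∧ j ∈ A') ∨ (i ∈ A' ∧ j ∈ A))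
    (fun i j => by simp only [eq_iff_iff]; tauto)]
  simp only [← hπ A hA, ← hπ A' hA']

theorem exists_permPair_eq {d : ℕ} {G : Finpartition (Finset.univ : Finset (Fin d))}
    {b : Finset (PairIdx d)} (hb : b ∈ blocks G) {r s : PairIdx d} (hr : r ∈ b) (hs : s ∈ b) :
    ∃ π : Equiv.Perm (Fin d), (∀ B ∈ G.parts, ∀ m, m ∈ B ↔ π m ∈ B) ∧ permPair π r = s := by
  simp only [blocks, Finset.mem_filter, Finset.mem_image, Finset.mem_product, Prod.exists] at hb
  obtain ⟨⟨A, A', ⟨hA, hA'⟩, rfl⟩, -⟩ := hb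
  simp only [block, Finset.mem_filter, Finset.mem_univ, true_and] at hr hs
  have key (i j k l : Fin d) (hij : i ≠ j) (hkl : k ≠ l)
      (h : (i ∈ A ∧ k ∈ A ∧ j ∈ A' ∧ l ∈ A') ∨ (i ∈ A' ∧ k ∈ A' ∧ j ∈ A ∧ l ∈ A)) :
      ∃ π : Equiv.Perm (Fin d), (∀ B ∈ G.parts, ∀ m, m ∈ B ↔ π m ∈ B) ∧ π i = k ∧ π j = l := by
    rcases h with ⟨h1, h2, h3, h4⟩ | ⟨h1, h2, h3, h4⟩
    · exact exists_perm_of_mem_block hA hA' h1 h2 h3 h4 hij hkl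
    · exact exists_perm_of_mem_block hA' hA h1 h2 h3 h4 hij hkl
  have hrs : ∃ π : Equiv.Perm (Fin d), (∀ B ∈ G.parts, ∀ m, m ∈ B ↔ π m ∈ B) ∧
      ((π r.1.1 = s.1.1 ∧ π r.1.2 = s.1.2) ∨ (π r.1.1 = s.1.2 ∧ π r.1.2 = s.1.1)) := by
    rcases hr with ⟨h1, h2⟩ | ⟨h1, h2⟩ <;> rcases hs with ⟨h3, h4⟩ | ⟨h3, h4⟩
    · obtain ⟨π, h, h'⟩ := key r.1.1 r.1.2 s.1.1 s.1.2 r.2.ne s.2.ne (by tauto)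
      exact ⟨π, h, Or.inl h'⟩
    · obtain ⟨π, h, h'⟩ := key r.1.1 r.1.2 s.1.2 s.1.1 r.2.ne s.2.ne' (by tauto)
      exact ⟨π, h, Or.inr h'⟩
    · obtain ⟨π, h, h'⟩ := key r.1.1 r.1.2 s.1.2 s.1.1 r.2.ne s.2.ne' (by tauto)
      exact ⟨π, h, Or.inr h'⟩
    · obtain ⟨π, h, h'⟩ := key r.1.1 r.1.2 s.1.1 s.1.2 r.2.ne s.2.ne (by tauto)
      exact ⟨π, h, Or.inl h'⟩
  obtain ⟨π, hπ, h⟩ := hrs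
  refine ⟨π, hπ, Subtype.ext (Prod.ext_iff.2 ?_)⟩
  unfold permPair
  rcases h with ⟨h1, h2⟩ | ⟨h1, h2⟩
  · have : π r.1.1 < π r.1.2 := by rw [h1, h2]; exact s.2
    rw [dif_pos this]
    exact ⟨h1, h2⟩
  · have : ¬ π r.1.1 < π r.1.2 := by rw [h1, h2]; exact s.2.asymm
    rw [dif_neg this]
    exact ⟨h2, h1⟩

section Invariance

variable {d : ℕ} {ν : Measure (Fin d → ℝ)}

theorem copulaSum_comm (i j : Fin d) : copulaSum ν i j = copulaSum ν j i := by
  funext u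
  simp only [copulaSum, copula₂, copulaSurvival₂, and_comm]

/-- Exchangeability moves a cluster-preserving permutation from the indices of `C_{ij} + C̄_{ij}` to
its argument. -/
theorem copulaSum_perm {π : Equiv.Perm (Fin d)}
    (hπ : (copulaLaw ν).map (fun u j => u (π j)) = copulaLaw ν) (i j : Fin d) (u : Fin d → ℝ) :
    copulaSum ν (π i) (π j) u = copulaSum ν i j fun k => u (π k) := by
  have hm : Measurable fun (u : Fin d → ℝ) j => u (π j) := by fun_prop
  simp only [copulaSum, copula₂, copulaSurvival₂]
  conv_rhs => rw [← hπ]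
  rw [map_measureReal_apply hm, map_measureReal_apply hm]
  · rfl
  · exact (measurableSet_lt (f := fun _ : Fin d → ℝ => u (π i)) (g := fun w => w i)
      (by fun_prop) (by fun_prop)).inter
      (measurableSet_lt (f := fun _ : Fin d → ℝ => u (π j)) (g := fun w => w j)
      (by fun_prop) (by fun_prop))
  · exact (measurableSet_le (g := fun _ : Fin d → ℝ => u (π i)) (f := fun w => w i)
      (by fun_prop) (by fun_prop)).inter
      (measurableSet_le (g := fun _ : Fin d → ℝ => u (π j)) (f := fun w => w j)
      (by fun_prop) (by fun_prop))

theorem copulaSum_permPair {π : Equiv.Perm (Fin d)}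
    (hπ : (copulaLaw ν).map (fun u j => u (π j)) = copulaLaw ν) (r : PairIdx d) (u : Fin d → ℝ) :
    copulaSum ν (permPair π r).1.1 (permPair π r).1.2 u =
      copulaSum ν r.1.1 r.1.2 fun k => u (π k) := by
  rw [apply_permPair copulaSum_comm, copulaSum_perm hπ]

theorem measurable_copulaSum [IsProbabilityMeasure ν] (i j : Fin d) :
    Measurable (copulaSum ν i j) := by
  have h1 : Measurable fun u : Fin d → ℝ => copula₂ ν i j (u i) (u j) := by
    simp_rw [← integral_concordance_left]
    exact (measurable_concordance i j).stronglyMeasurable.integral_prod_left.measurable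
  have hms : MeasurableSet {p : (Fin d → ℝ) × (Fin d → ℝ) | p.1 i < p.2 i ∧ p.1 j < p.2 j} :=
    (measurableSet_lt (f := fun p : (Fin d → ℝ) × (Fin d → ℝ) => p.1 i) (g := fun p => p.2 i)
      (by fun_prop) (by fun_prop)).inter
    (measurableSet_lt (f := fun p : (Fin d → ℝ) × (Fin d → ℝ) => p.1 j) (g := fun p => p.2 j)
      (by fun_prop) (by fun_prop))
  exact h1.add (measurable_measure_prodMk_left (ν := copulaLaw ν) hms).ennreal_toReal

theorem SigmaInf_apply (r s : PairIdx d) : SigmaInf ν r s =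
    16 * cov[copulaSum ν r.1.1 r.1.2, copulaSum ν s.1.1 s.1.2; copulaLaw ν] := rfl

theorem SigmaInf_transpose : (SigmaInf ν)ᵀ = SigmaInf ν := by
  ext r s
  rw [Matrix.transpose_apply, SigmaInf_apply, SigmaInf_apply, covariance_comm]

theorem SigmaInf_permPair [IsProbabilityMeasure ν] {π : Equiv.Perm (Fin d)}
    (hπ : (copulaLaw ν).map (fun u j => u (π j)) = copulaLaw ν) (r s : PairIdx d) :
    SigmaInf ν (permPair π r) (permPair π s) = SigmaInf ν r s := by
  have h (r : PairIdx d) : copulaSum ν (permPair π r).1.1 (permPair π r).1.2 =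
      copulaSum ν r.1.1 r.1.2 ∘ fun u j => u (π j) := funext (copulaSum_permPair hπ r)
  rw [SigmaInf_apply, SigmaInf_apply, h, h, ← covariance_map, hπ]
  · rw [hπ]; exact (measurable_copulaSum _ _).aestronglyMeasurable
  · rw [hπ]; exact (measurable_copulaSum _ _).aestronglyMeasurable
  · exact Measurable.aemeasurable (by fun_prop)

theorem integral_copulaSum_permPair [IsProbabilityMeasure ν] {π : Equiv.Perm (Fin d)}
    (hπ : (copulaLaw ν).map (fun u j => u (π j)) = copulaLaw ν) (r : PairIdx d) :
    ∫ u, copulaSum ν (permPair π r).1.1 (permPair π r).1.2 u ∂copulaLaw ν =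
      ∫ u, copulaSum ν r.1.1 r.1.2 u ∂copulaLaw ν := by
  simp_rw [copulaSum_permPair hπ r]
  conv_rhs => rw [← hπ]
  rw [integral_map (Measurable.aemeasurable (by fun_prop))
    (measurable_copulaSum _ _).aestronglyMeasurable]

variable {G : Finpartition (Finset.univ : Finset (Fin d))}

/-- `Σ_∞` is invariant under the permutations that preserve the clusters. These act transitively on
each block, so `Σ_∞` maps block-constant vectors to block-constant vectors. -/
theorem Gam_mul_SigmaInf [IsProbabilityMeasure ν] (hG : PEA ν G) :
    Gam G * SigmaInf ν = SigmaInf ν * Gam G := by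
  refine Gam_mul_comm SigmaInf_transpose fun b hb r hr r' hr' c hc => ?_
  obtain ⟨π, hπ, rfl⟩ := exists_permPair_eq hb hr hr'
  refine Finset.sum_bijective (permPair π)
    (Finite.injective_iff_bijective.1 (permPair_injective π))
    (fun s => (permPair_mem_iff hπ hc s).symm) fun s _ => ?_
  rw [SigmaInf_permPair (hG π hπ)]

/-- The population vector of Kendall's taus, `-1 + 2 E(C_{ij} + C̄_{ij})(U_i, U_j)`. -/
noncomputable def tauPop (ν : Measure (Fin d → ℝ)) (r : PairIdx d) : ℝ :=
  -1 + 4 * ((∫ u, copulaSum ν r.1.1 r.1.2 u ∂copulaLaw ν) / 2)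

theorem Gam_mulVec_tauPop [IsProbabilityMeasure ν] (hG : PEA ν G) :
    Gam G *ᵥ tauPop ν = tauPop ν := by
  refine Gam_mulVec_of_forall_block fun b hb r hr s hs => ?_
  obtain ⟨π, hπ, rfl⟩ := exists_permPair_eq hb hr hs
  rw [tauPop, tauPop, integral_copulaSum_permPair (hG π hπ)]

end Invariance

/-! ### Convergence in distribution and in probability -/

section Convergence

variable {Ω Ω' : Type*} [MeasurableSpace Ω] [MeasurableSpace Ω'] {P : Measure Ω}
  {P' : Measure Ω'}

theorem charFun_map_inner {E : Type*} [NormedAddCommGroup E] [InnerProductSpace ℝ E]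
    [MeasurableSpace E] [BorelSpace E] [SecondCountableTopology E] {Q : Measure Ω} {V : Ω → E}
    (hV : AEMeasurable V Q) (t : E) :
    charFun (Q.map fun ω => inner ℝ (V ω) t) 1 = charFun (Q.map V) t := by
  rw [charFun_apply, charFun_apply, integral_map hV (by fun_prop),
    integral_map (by fun_prop) (by fun_prop)]
  simp

/-- The Cramér-Wold device. -/
theorem tendstoInDistribution_of_forall_inner [IsProbabilityMeasure P] [IsProbabilityMeasure P']
    {E : Type*} [NormedAddCommGroup E]
    [InnerProductSpace ℝ E] [FiniteDimensional ℝ E] [MeasurableSpace E] [BorelSpace E]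
    {W : ℕ → Ω → E} {Z : Ω' → E} (hW : ∀ n, AEMeasurable (W n) P) (hZ : AEMeasurable Z P')
    (h : ∀ t : E, TendstoInDistribution (fun n ω => inner ℝ (W n ω) t) atTop
      (fun ω => inner ℝ (Z ω) t) (fun _ => P) P') :
    TendstoInDistribution W atTop Z (fun _ => P) P' where
  forall_aemeasurable := hW
  aemeasurable_limit := hZ
  tendsto := by
    refine ProbabilityMeasure.tendsto_iff_tendsto_charFun.2 fun t => ?_
    have h1 := ProbabilityMeasure.tendsto_iff_tendsto_charFun.1 (h t).tendsto 1
    simpa only [ProbabilityMeasure.coe_mk, charFun_map_inner (hW _), charFun_map_inner hZ] using h1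

/-- Convergence in distribution only depends on the law of the limit, which may be represented by
the identity map. -/
theorem tendstoInDistribution_of_map_eq [IsProbabilityMeasure P] [IsProbabilityMeasure P']
    {E : Type*} [TopologicalSpace E] [MeasurableSpace E]
    [OpensMeasurableSpace E] {W : ℕ → Ω → E} {Z : Ω' → E} {μ : Measure E}
    [IsProbabilityMeasure μ] (h : TendstoInDistribution W atTop Z (fun _ => P) P')
    (hμ : P'.map Z = μ) :
    TendstoInDistribution W atTop (fun y : E => y) (fun _ => P) μ where
  forall_aemeasurable := h.forall_aemeasurable
  aemeasurable_limit := aemeasurable_id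
  tendsto := by
    subst hμ
    simpa only [Measure.map_id'] using h.tendsto

/-- Continuous mapping for entrywise convergence in probability to a constant, at which alone
continuity is needed. -/
theorem tendstoInMeasure_comp_of_continuousAt {ι κ F : Type*} [Fintype κ] [PseudoMetricSpace F]
    {l : Filter ι} {f : ι → Ω → κ → ℝ} {c : κ → ℝ}
    (hf : ∀ k, TendstoInMeasure P (fun i ω => f i ω k) l (fun _ => c k)) {φ : (κ → ℝ) → F}
    (hφ : ContinuousAt φ c) :
    TendstoInMeasure P (fun i ω => φ (f i ω)) l (fun _ => φ c) := by
  rw [tendstoInMeasure_iff_dist]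
  intro ε hε
  obtain ⟨δ, hδ, hφδ⟩ := Metric.continuousAt_iff.1 hφ ε hε
  have hsum : Tendsto (fun i => ∑ k, P {ω | δ ≤ dist (f i ω k) (c k)}) l (𝓝 0) := by
    simpa using tendsto_finsetSum Finset.univ fun k _ =>
      (tendstoInMeasure_iff_dist.1 (hf k)) δ hδ
  refine tendsto_of_tendsto_of_tendsto_of_le_of_le tendsto_const_nhds hsum
    (fun _ => zero_le) fun i => ?_
  refine (measure_mono ?_).trans (measure_iUnion_fintype_le P fun k => _)
  intro ω hω
  by_contra hcon
  simp only [Set.mem_iUnion, Set.mem_ofPred_eq, not_exists, not_le] at hcon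
  exact absurd (hφδ ((dist_pi_lt_iff hδ).2 hcon)) (not_lt.2 hω)

end Convergence

theorem tendstoInDistribution_of_eventually_ae_eq {Ω Ω' E : Type*} [MeasurableSpace Ω]
    [MeasurableSpace Ω'] {P : Measure Ω} [IsProbabilityMeasure P] {P' : Measure Ω'}
    [IsProbabilityMeasure P'] [SeminormedAddCommGroup E] [SecondCountableTopology E]
    [MeasurableSpace E] [BorelSpace E] {W V : ℕ → Ω → E} {Z : Ω' → E}
    (h : TendstoInDistribution W atTop Z (fun _ => P) P') (hV : ∀ n, AEMeasurable (V n) P)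
    (hWV : ∀ᶠ n in atTop, W n =ᵐ[P] V n) :
    TendstoInDistribution V atTop Z (fun _ => P) P' := by
  refine tendstoInDistribution_of_tendstoInMeasure_sub V Z h ?_ hV
  have h0 : TendstoInMeasure P (fun _ : ℕ => (0 : Ω → E)) atTop 0 := by
    intro ε hε
    simp [hε.ne']
  refine h0.congr' ?_ (by rfl)
  filter_upwards [hWV] with n hn
  filter_upwards [hn] with ω hω
  simp [hω]

/-- The entries of the inverse of the matrix with entries `v`. Matrices are flattened to functions
on pairs here, which carry the sup norm; the value is `0` where the matrix is singular. -/
noncomputable def invEntries {n : Type*} [Fintype n] [DecidableEq n] (v : n × n → ℝ) :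
    n × n → ℝ :=
  fun p => (Matrix.of fun r s => v (r, s))⁻¹ p.1 p.2

theorem invEntries_apply {n : Type*} [Fintype n] [DecidableEq n] (v : n × n → ℝ) (p : n × n) :
    invEntries v p = (Matrix.of fun r s => v (r, s)).det⁻¹ *
      (Matrix.of fun r s => v (r, s)).adjugate p.1 p.2 := by
  rw [invEntries, Matrix.inv_def, Ring.inverse_eq_inv', Matrix.smul_apply, smul_eq_mul]

theorem continuous_of_entries {n : Type*} :
    Continuous fun v : n × n → ℝ => Matrix.of fun r s => v (r, s) :=
  continuous_matrix fun r s => continuous_apply (r, s)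

theorem measurable_invEntries {n : Type*} [Fintype n] [DecidableEq n] :
    Measurable (invEntries (n := n)) := by
  refine measurable_pi_lambda _ fun p => ?_
  simp_rw [invEntries_apply]
  exact continuous_of_entries.matrix_det.measurable.inv.mul
    (continuous_of_entries.matrix_adjugate.matrix_elem p.1 p.2).measurable

theorem continuousAt_invEntries {n : Type*} [Fintype n] [DecidableEq n] {v : n × n → ℝ}
    (hv : (Matrix.of fun r s => v (r, s)).det ≠ 0) : ContinuousAt invEntries v := by
  refine continuousAt_pi.2 fun p => ?_
  simp_rw [invEntries_apply]
  exact (continuous_of_entries.matrix_det.continuousAt.inv₀ hv).mul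
    (continuous_of_entries.matrix_adjugate.matrix_elem p.1 p.2).continuousAt

/-! ### Asymptotic normality of the empirical Kendall's taus -/

section KendallCLT

variable {Ω Ω' : Type*} [MeasurableSpace Ω] [MeasurableSpace Ω'] {P : Measure Ω}
  {P' : Measure Ω'} {d : ℕ}
  {ν : Measure (Fin d → ℝ)} [IsProbabilityMeasure ν] {X : ℕ → Ω → Fin d → ℝ}

theorem abs_copulaSum_le (i j : Fin d) (u : Fin d → ℝ) : |copulaSum ν i j u| ≤ 2 := by
  have h1 : copula₂ ν i j (u i) (u j) ≤ 1 := measureReal_le_one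
  have h2 : copulaSurvival₂ ν i j (u i) (u j) ≤ 1 := measureReal_le_one
  have h3 : 0 ≤ copula₂ ν i j (u i) (u j) := measureReal_nonneg
  have h4 : 0 ≤ copulaSurvival₂ ν i j (u i) (u j) := measureReal_nonneg
  rw [copulaSum, abs_le]
  constructor <;> linarith

theorem variance_sum_copulaSum (c : PairIdx d → ℝ) :
    Var[fun u => ∑ r, c r * (4 * copulaSum ν r.1.1 r.1.2 u); copulaLaw ν] =
      c ⬝ᵥ (SigmaInf ν *ᵥ c) := by
  have hmem (r : PairIdx d) :
      MemLp (fun u => c r * (4 * copulaSum ν r.1.1 r.1.2 u)) 2 (copulaLaw ν) := by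
    have h : MemLp (copulaSum ν r.1.1 r.1.2) 2 (copulaLaw ν) :=
      MemLp.of_bound (measurable_copulaSum _ _).aestronglyMeasurable 2
        (ae_of_all _ (abs_copulaSum_le _ _))
    exact (h.const_mul 4).const_mul (c r)
  have hm : Measurable fun u => ∑ r : PairIdx d, c r * (4 * copulaSum ν r.1.1 r.1.2 u) :=
    Finset.measurable_fun_sum _ fun r _ =>
      ((measurable_copulaSum _ _).const_mul 4).const_mul (c r)
  rw [← covariance_self hm.aemeasurable, covariance_fun_sum_fun_sum hmem hmem]
  simp only [dotProduct, Matrix.mulVec, Finset.mul_sum, SigmaInf_apply]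
  refine Finset.sum_congr rfl fun r _ => Finset.sum_congr rfl fun s _ => ?_
  simp only [covariance_const_mul_left, covariance_const_mul_right]
  ring

theorem aemeasurable_tauHat (hX : ∀ n, AEMeasurable (X n) P) (n : ℕ) :
    AEMeasurable (fun ω => tauHat n fun k => X k ω) P := by
  refine aemeasurable_pi_lambda _ fun q => ?_
  simp_rw [tauHat_eq_sum_concordance]
  refine ((AEMeasurable.const_mul ?_ _).const_mul 4).const_add (-1)
  exact Finset.aemeasurable_fun_sum _ fun p _ =>
    (measurable_concordance _ _).comp_aemeasurable ((hX _).prodMk (hX _))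

/-- Asymptotic normality of the linear combinations of the empirical Kendall's taus. -/
theorem tendstoInDistribution_dotProduct_tauHat [IsProbabilityMeasure P] [IsProbabilityMeasure P']
   
    (hcont : ∀ j, Continuous (cdf (ν.map (fun x => x j))))
    (hindep : iIndepFun X P) (hlaw : ∀ n, HasLaw (X n) ν P) (c : PairIdx d → ℝ) {Y : Ω' → ℝ}
    (hY : HasLaw Y (gaussianReal 0 (c ⬝ᵥ (SigmaInf ν *ᵥ c)).toNNReal) P') :
    TendstoInDistribution
      (fun (n : ℕ) ω => √n * (c ⬝ᵥ ((tauHat n fun k => X k ω) - tauPop ν))) atTop Y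
      (fun _ => P) P' := by
  set h : (Fin d → ℝ) → (Fin d → ℝ) → ℝ :=
    fun x y => ∑ r : PairIdx d, c r * (4 * concordance r.1.1 r.1.2 x y) with h_def
  have hh : Measurable (Function.uncurry h) :=
    Finset.measurable_fun_sum _ fun r _ => ((measurable_concordance _ _).const_mul 4).const_mul _
  have hM (x y : Fin d → ℝ) : |h x y| ≤ ∑ r : PairIdx d, |c r| * (4 * 1) := by
    refine (Finset.abs_sum_le_sum_abs _ _).trans (Finset.sum_le_sum fun r _ => ?_)
    rw [abs_mul, abs_mul, abs_of_pos (by norm_num : (0 : ℝ) < 4)]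
    gcongr
    exact abs_concordance_le_one _ _ _ _
  have hproj (x : Fin d → ℝ) :
      ∫ y, h x y ∂copulaLaw ν + ∫ y, h y x ∂copulaLaw ν =
        ∑ r : PairIdx d, c r * (4 * copulaSum ν r.1.1 r.1.2 x) := by
    have i1 (r : PairIdx d) : Integrable (fun y => concordance r.1.1 r.1.2 x y) (copulaLaw ν) :=
      Integrable.of_bound ((measurable_concordance _ _).comp
        measurable_prodMk_left).aestronglyMeasurable 1
        (ae_of_all _ fun y => abs_concordance_le_one _ _ _ _)
    have i2 (r : PairIdx d) : Integrable (fun y => concordance r.1.1 r.1.2 y x) (copulaLaw ν) :=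
      Integrable.of_bound ((measurable_concordance _ _).comp
        measurable_prodMk_right).aestronglyMeasurable 1
        (ae_of_all _ fun y => abs_concordance_le_one _ _ _ _)
    simp only [h_def]
    rw [integral_finsetSum _ fun r _ => ((i1 r).const_mul 4).const_mul (c r),
      integral_finsetSum _ fun r _ => ((i2 r).const_mul 4).const_mul (c r),
      ← Finset.sum_add_distrib]
    refine Finset.sum_congr rfl fun r _ => ?_
    rw [integral_const_mul, integral_const_mul, integral_const_mul, integral_const_mul,
      ← integral_concordance_add hcont]
    ring
  have hindepU : iIndepFun (fun n ω => probTransform ν (X n ω)) P :=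
    hindep.comp (fun _ => probTransform ν) fun _ => measurable_probTransform
  have hlawU (n : ℕ) := hasLaw_probTransform (hlaw n)
  have clt := tendstoInDistribution_uStatistic hindepU hlawU hh hM (Y := Y) (P' := P') (by
    simp_rw [hproj, variance_sum_copulaSum]
    exact hY)
  refine clt.congr (fun n => ?_) (by rfl)
  filter_upwards [tauHat_probTransform_ae_eq hcont hindep hlaw] with ω hω
  rw [← hω n]
  congr 1
  simp_rw [hproj]
  have hint (r : PairIdx d) :
      Integrable (fun u => c r * (4 * copulaSum ν r.1.1 r.1.2 u)) (copulaLaw ν) :=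
    ((Integrable.of_bound (measurable_copulaSum _ _).aestronglyMeasurable 2
        (ae_of_all _ (abs_copulaSum_le _ _))).const_mul 4).const_mul (c r)
  rw [integral_finsetSum _ fun r _ => hint r]
  simp only [h_def, dotProduct, Pi.sub_apply, tauHat_eq_sum_concordance, tauPop]
  rw [Finset.sum_comm, Finset.mul_sum, Finset.sum_div, ← Finset.sum_sub_distrib]
  refine Finset.sum_congr rfl fun r _ => ?_
  rw [integral_const_mul, integral_const_mul, ← Finset.mul_sum, ← Finset.mul_sum]
  ring

theorem hasLaw_inner_stdGaussian {k : ℕ} (t : EuclideanSpace ℝ (Fin k)) :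
    HasLaw (fun w => inner ℝ w t) (gaussianReal 0 (‖t‖ ^ 2).toNNReal)
      (stdGaussian (EuclideanSpace ℝ (Fin k))) where
  aemeasurable := Measurable.aemeasurable (by fun_prop)
  map_eq := by
    have h := IsGaussian.map_eq_gaussianReal (μ := stdGaussian (EuclideanSpace ℝ (Fin k)))
      (innerSL ℝ t)
    rw [integral_strongDual_stdGaussian, variance_dual_stdGaussian, innerSL_apply_norm] at h
    rw [← h]
    congr 1
    funext w
    exact (real_inner_comm _ _)

/-- If `A` whitens `Σ_∞`, then `√n A (τ̂ - τ)` is asymptotically standard normal. -/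
theorem tendstoInDistribution_whitened_tauHat [IsProbabilityMeasure P]
    (hcont : ∀ j, Continuous (cdf (ν.map (fun x => x j))))
    (hindep : iIndepFun X P) (hlaw : ∀ n, HasLaw (X n) ν P) {k : ℕ}
    {A : Matrix (Fin k) (PairIdx d) ℝ} (hA : A * SigmaInf ν * Aᵀ = 1) :
    TendstoInDistribution
      (fun (n : ℕ) ω => WithLp.toLp 2 (√n • (A *ᵥ ((tauHat n fun k => X k ω) - tauPop ν))))
      atTop (fun w : EuclideanSpace ℝ (Fin k) => w) (fun _ => P)
      (stdGaussian (EuclideanSpace ℝ (Fin k))) := by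
  refine tendstoInDistribution_of_forall_inner (fun n => ?_) aemeasurable_id fun t => ?_
  · have hc : Continuous fun v : PairIdx d → ℝ =>
        WithLp.toLp 2 (√n • (A *ᵥ (v - tauPop ν))) := by fun_prop
    exact hc.measurable.comp_aemeasurable
      (aemeasurable_tauHat (fun m => (hlaw m).aemeasurable) n)
  · have hvar : (Aᵀ *ᵥ t.ofLp) ⬝ᵥ (SigmaInf ν *ᵥ (Aᵀ *ᵥ t.ofLp)) = ‖t‖ ^ 2 := by
      rw [Matrix.mulVec_transpose, ← Matrix.dotProduct_mulVec, ← Matrix.mulVec_transpose,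
        Matrix.mulVec_mulVec, Matrix.mulVec_mulVec, hA, Matrix.one_mulVec,
        EuclideanSpace.real_norm_sq_eq]
      simp [dotProduct, sq]
    have h := tendstoInDistribution_dotProduct_tauHat hcont hindep hlaw (Aᵀ *ᵥ t.ofLp)
      (by rw [hvar]; exact hasLaw_inner_stdGaussian t)
    refine h.congr (fun n => ae_of_all _ fun ω => ?_) (by rfl)
    simp only [EuclideanSpace.inner_eq_star_dotProduct, star_trivial]
    rw [dotProduct_smul, smul_eq_mul, Matrix.mulVec_transpose, ← Matrix.dotProduct_mulVec]

end KendallCLT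

/-! ### The limit of the loss -/

/-- Moves the rate `n` of the covariance estimator onto the vector of the quadratic form. -/
theorem inv_natCast_smul_quadratic {m : Type*} [Fintype m] [DecidableEq m] {n : ℕ} (hn : n ≠ 0)
    {T : Matrix m m ℝ} (hT : IsUnit T) (v : m → ℝ) :
    (√n • v) ⬝ᵥ (((n : ℝ) • T)⁻¹ *ᵥ (√n • v)) = v ⬝ᵥ (T⁻¹ *ᵥ v) := by
  have hn' : (n : ℝ) ≠ 0 := by exact_mod_cast hn
  have hinv : ((n : ℝ) • T)⁻¹ = (n : ℝ)⁻¹ • T⁻¹ :=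
    Matrix.inv_smul' T (Units.mk0 (n : ℝ) hn') ((Matrix.isUnit_iff_isUnit_det _).1 hT)
  rw [hinv, Matrix.smul_mulVec, Matrix.mulVec_smul, smul_dotProduct, dotProduct_smul,
    dotProduct_smul, smul_eq_mul, smul_eq_mul, smul_eq_mul]
  calc √n * ((n : ℝ)⁻¹ * (√n * (v ⬝ᵥ T⁻¹ *ᵥ v)))
      = (√n * √n) * (n : ℝ)⁻¹ * (v ⬝ᵥ T⁻¹ *ᵥ v) := by ring
    _ = v ⬝ᵥ T⁻¹ *ᵥ v := by
      rw [Real.mul_self_sqrt (Nat.cast_nonneg n), mul_inv_cancel₀ hn', one_mul]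

theorem of_invEntries {n : Type*} [Fintype n] [DecidableEq n] (T : Matrix n n ℝ) :
    (Matrix.of fun r s => invEntries (fun p => T p.1 p.2) (r, s)) = T⁻¹ := rfl

theorem continuous_quadratic_residual {m n : Type*} [Fintype m] (B : Matrix n m ℝ) [Fintype n] :
    Continuous fun q : (m → ℝ) × (n × n → ℝ) =>
      (B *ᵥ q.1) ⬝ᵥ ((Matrix.of fun r s => q.2 (r, s)) *ᵥ (B *ᵥ q.1)) := by
  have h1 : Continuous fun q : (m → ℝ) × (n × n → ℝ) => B *ᵥ q.1 := by fun_prop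
  exact h1.dotProduct ((continuous_of_entries.comp continuous_snd).matrix_mulVec h1)

theorem aemeasurable_loss {Ω : Type*} [MeasurableSpace Ω] {P : Measure Ω} {d : ℕ}
    {G : Finpartition (Finset.univ : Finset (Fin d))} {τ : Ω → PairIdx d → ℝ}
    (hτ : AEMeasurable τ P) {S : Ω → Matrix (PairIdx d) (PairIdx d) ℝ}
    (hS : ∀ r s, AEMeasurable (fun ω => S ω r s) P) :
    AEMeasurable (fun ω => loss (tauTilde G (τ ω)) (τ ω) (S ω)) P := by
  have hm : AEMeasurable (fun ω (p : PairIdx d × PairIdx d) => S ω p.1 p.2) P :=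
    aemeasurable_pi_lambda _ fun p => hS p.1 p.2
  have h := (continuous_quadratic_residual (1 - Gam G)).measurable.comp_aemeasurable
    (hτ.prodMk (measurable_invEntries.comp_aemeasurable hm))
  refine h.congr (ae_of_all _ fun ω => ?_)
  simp only [Function.comp_apply, of_invEntries, loss, tauTilde, Matrix.sub_mulVec,
    Matrix.one_mulVec]

/-- Under a whitening matrix `A` for the range of `1 - Γ`, the loss is a continuous function of the
asymptotically standard normal vector `√n A (τ̂ - τ)` and of `(n Σ̂)⁻¹ → Σ_∞⁻¹`. In the limit it is
the squared norm of the normal vector. -/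
theorem tendstoInDistribution_loss {Ω : Type*} [MeasurableSpace Ω] {P : Measure Ω}
    [IsProbabilityMeasure P] {d : ℕ} {ν : Measure (Fin d → ℝ)} [IsProbabilityMeasure ν]
    (hcont : ∀ j, Continuous (cdf (ν.map (fun x => x j)))) {X : ℕ → Ω → Fin d → ℝ}
    (hindep : iIndepFun X P) (hlaw : ∀ n, HasLaw (X n) ν P)
    {G : Finpartition (Finset.univ : Finset (Fin d))} (hG : PEA ν G)
    (hSu : IsUnit (SigmaInf ν).det)
    {Shat : ℕ → Ω → Matrix (PairIdx d) (PairIdx d) ℝ}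
    (hmeas : ∀ n r s, AEMeasurable (fun ω => Shat n ω r s) P)
    (hinv : ∀ᶠ n in atTop, ∀ᵐ ω ∂P, IsUnit (Shat n ω))
    (hconv : ∀ r s, TendstoInMeasure P (fun (n : ℕ) ω => (n : ℝ) * Shat n ω r s) atTop
      (fun _ => SigmaInf ν r s)) {k : ℕ} {A : Matrix (Fin k) (PairIdx d) ℝ}
    (hA1 : A * SigmaInf ν * Aᵀ = 1) (hA2 : SigmaInf ν * Aᵀ * A = 1 - Gam G) :
    TendstoInDistribution
      (fun n ω => loss (tauTilde G (tauHat n fun k => X k ω)) (tauHat n fun k => X k ω)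
        (Shat n ω))
      atTop (fun y : ℝ => y) (fun _ => P) (chiSquared k) := by
  obtain ⟨D, hD⟩ : ∃ D, D = SigmaInf ν * Aᵀ := ⟨_, rfl⟩
  rw [← hD] at hA2
  have hXm (n : ℕ) := (hlaw n).aemeasurable
  -- The population taus are block-constant, so `1 - Γ = D A` sees only the deviation from them.
  have hres (τ : PairIdx d → ℝ) : τ - tauTilde G τ = D *ᵥ (A *ᵥ (τ - tauPop ν)) := by
    rw [Matrix.mulVec_mulVec, hA2, Matrix.mulVec_sub, Matrix.sub_mulVec, Matrix.sub_mulVec,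
      Gam_mulVec_tauPop hG, tauTilde]
    simp
  have hW := tendstoInDistribution_whitened_tauHat hcont hindep hlaw hA1
  have hSm (n : ℕ) :
      AEMeasurable (fun ω => fun p : PairIdx d × PairIdx d => (n : ℝ) * Shat n ω p.1 p.2) P :=
    aemeasurable_pi_lambda _ fun p => (hmeas n p.1 p.2).const_mul _
  have hInv : TendstoInMeasure P (fun (n : ℕ) ω =>
      invEntries fun p : PairIdx d × PairIdx d => (n : ℝ) * Shat n ω p.1 p.2) atTop
      (fun _ => invEntries fun p => SigmaInf ν p.1 p.2) :=
    tendstoInMeasure_comp_of_continuousAt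
      (f := fun (n : ℕ) ω (p : PairIdx d × PairIdx d) => (n : ℝ) * Shat n ω p.1 p.2)
      (c := fun p => SigmaInf ν p.1 p.2) (φ := invEntries) (fun p => hconv p.1 p.2)
      (continuousAt_invEntries hSu.ne_zero)
  let g : EuclideanSpace ℝ (Fin k) × (PairIdx d × PairIdx d → ℝ) → ℝ := fun q =>
    (D *ᵥ q.1.ofLp) ⬝ᵥ ((Matrix.of fun r s => q.2 (r, s)) *ᵥ (D *ᵥ q.1.ofLp))
  have hg : Continuous g := (continuous_quadratic_residual D).comp
    (((PiLp.continuous_ofLp 2 _).comp continuous_fst).prodMk continuous_snd)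
  have hlim := hW.continuous_comp_prodMk_of_tendstoInMeasure_const hg hInv
    fun n => measurable_invEntries.comp_aemeasurable (hSm n)
  have hquad (w : EuclideanSpace ℝ (Fin k)) :
      g (w, invEntries fun p => SigmaInf ν p.1 p.2) = ∑ i, w i ^ 2 := by
    have hD' : Dᵀ = A * SigmaInf ν := by
      rw [hD, Matrix.transpose_mul, Matrix.transpose_transpose, SigmaInf_transpose]
    have hwhite : Dᵀ * (SigmaInf ν)⁻¹ * D = 1 := by
      rw [Matrix.mul_assoc, hD', hD, ← Matrix.mul_assoc (SigmaInf ν)⁻¹,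
        Matrix.nonsing_inv_mul _ hSu, Matrix.one_mul, hA1]
    change (D *ᵥ w.ofLp) ⬝ᵥ ((SigmaInf ν)⁻¹ *ᵥ (D *ᵥ w.ofLp)) = _
    rw [← Matrix.vecMul_transpose, ← Matrix.dotProduct_mulVec, Matrix.mulVec_mulVec,
      Matrix.vecMul_transpose, Matrix.mulVec_mulVec, hwhite, Matrix.one_mulVec]
    simp [dotProduct, sq]
  have hchi : (stdGaussian (EuclideanSpace ℝ (Fin k))).map
      (fun w => g (w, invEntries fun p => SigmaInf ν p.1 p.2)) = chiSquared k := by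
    simp_rw [hquad]
    rw [← map_pi_eq_stdGaussian, Measure.map_map (by fun_prop) (by fun_prop), chiSquared]
    rfl
  refine tendstoInDistribution_of_eventually_ae_eq
    (tendstoInDistribution_of_map_eq hlim hchi) (fun n => ?_) ?_
  · exact aemeasurable_loss (aemeasurable_tauHat hXm n) (hmeas n)
  · filter_upwards [hinv, eventually_ne_atTop 0] with n hn hn0
    filter_upwards [hn] with ω hω
    rw [loss, hres, ← inv_natCast_smul_quadratic hn0 hω, ← Matrix.mulVec_smul D]
    rfl

/-- Let `X 0, X 1, …` be independent copies of a `d`-dimensional random vector with law `ν` and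
continuous marginals, and let `G` satisfy the partial exchangeability assumption. If `Σ_∞` is
positive definite and `Shat n` is an invertible estimator with `n Shat n → Σ_∞` entrywise in
probability, then the loss of `τ̃` converges in distribution to `χ²` with `p - L` degrees of
freedom, where `p = d (d - 1) / 2`. -/
theorem proposition4 {Ω : Type*} [MeasurableSpace Ω] (P : Measure Ω) [IsProbabilityMeasure P]
    (d : ℕ) (ν : Measure (Fin d → ℝ)) [IsProbabilityMeasure ν]
    (hcont : ∀ j, Continuous (cdf (ν.map (fun x => x j))))
    (X : ℕ → Ω → Fin d → ℝ)
    (hindep : iIndepFun X P) (hlaw : ∀ n, HasLaw (X n) ν P)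
    (G : Finpartition (Finset.univ : Finset (Fin d))) (hG : PEA ν G)
    (hpos : (SigmaInf ν).PosDef)
    (Shat : ℕ → Ω → Matrix (PairIdx d) (PairIdx d) ℝ)
    (hmeas : ∀ n r s, AEMeasurable (fun ω => Shat n ω r s) P)
    (hinv : ∀ᶠ n in atTop, ∀ᵐ ω ∂P, IsUnit (Shat n ω))
    (hconv : ∀ r s, TendstoInMeasure P (fun (n : ℕ) ω => (n : ℝ) * Shat n ω r s) atTop
      (fun _ => SigmaInf ν r s)) :
    TendstoInDistribution
      (fun n ω => loss (tauTilde G (tauHat n fun k => X k ω)) (tauHat n fun k => X k ω)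
        (Shat n ω))
      atTop (fun y : ℝ => y) (fun _ => P) (chiSquared (d * (d - 1) / 2 - numBlocks G)) := by
  set k := d * (d - 1) / 2 - numBlocks G 
  set Q : Matrix (PairIdx d) (PairIdx d) ℝ := 1 - Gam G with hQ
  have hcomm : Q * SigmaInf ν = SigmaInf ν * Q := by
    rw [hQ, Matrix.sub_mul, Matrix.mul_sub, Matrix.one_mul, Matrix.mul_one, Gam_mul_SigmaInf hG]
  have hQt : Qᵀ = Q := by rw [hQ, Matrix.transpose_sub, Matrix.transpose_one, Gam_transpose]
  have hQQ : Q * Q = Q := by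
    rw [hQ, Matrix.sub_mul, Matrix.mul_sub, Matrix.mul_sub, Gam_mul_Gam]
    simp
  have hrank : Q.rank = k := by
    rw [hQ, rank_one_sub_of_isIdempotentElem (Gam_mul_Gam G), rank_Gam, card_blocks, card_pairIdx]
  obtain ⟨A, hA1, hA2⟩ := exists_mul_mul_transpose_eq_one hpos hQt hQQ hcomm hrank
  exact tendstoInDistribution_loss hcont hindep hlaw hG
    ((Matrix.isUnit_iff_isUnit_det _).1 hpos.isUnit) hmeas hinv hconv hA1 hA2
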